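/- Let $k,l\in\mathbb R$ satisfy $k>-1$, $l>-1/2$, $k+l+1/2>0$ and $k<l+3/2$. Put $E_{\min}=-\infty$ in case (a) and $E_{\min}=0$ in case (b). Let $E_0>E_{\min}$ be a real number, let $c,\delta>0$, and let $\phi:(E_{\min},\infty)\to[0,\infty)$ be measurable with $\phi(E)=0$ for all $E\ge E_0$, with $\phi\in L^\infty_{\rm loc}((E_{\min},E_0))$, and with $$\phi(E)=c\,(E_0-E)^k+O\big((E_0-E)^{k+\delta}\big)\quad\text{as } E\to E_0^-.$$ For $x,v\in\mathbb R^3$ write $r=|x|$ and $L(x,v)=|x\times v|^2$. (a) (Vlasov–Poisson system.) Let $U\in C^1([0,\infty))$ and put $f(x,v)=\phi(E)L^l$ with $E=E(x,v)=\tfrac12|v|^2+U(r)$. Let $\rho(r)=\rho(x)=\int_{\mathbb R^3} f(x,v)\,dv$ (which depends only on $r=|x|$), and suppose that $$U'(r)=\frac{4\pi}{r^2}\int_0^r s^2\rho(s)\,ds\qquad\text{for all } r>0.$$ Then $f$ has compact support in $\mathbb R^3\times\mathbb R^3$, and its mass $\int_{\mathbb R^3}\rho(x)\,dx$ is finite.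 (b) (Vlasov–Einstein system.) Let $\lambda,\mu\in C^1([0,\infty))$ and put $f(x,v)=\phi(E)L^l$ with $E=E(x,v)=e^{\mu(r)}\sqrt{1+|v|^2}$. Let $$\rho(r)=\rho(x)=\int_{\mathbb R^3}\sqrt{1+|v|^2}\,f(x,v)\,dv,\qquad p(r)=p(x)=\int_{\mathbb R^3}\Big(\frac{x\cdot v}{r}\Big)^2 f(x,v)\,\frac{dv}{\sqrt{1+|v|^2}}$$ (which depend only on $r=|x|$), and suppose that for all $r>0$ $$e^{-2\lambda}(2r\lambda'-1)+1=8\pi r^2\rho,\qquad e^{-2\lambda}(2r\mu'+1)-1=8\pi r^2 p.$$ Then $f$ has compact support in $\mathbb R^3\times\mathbb R^3$, and its ADM mass $\int_{\mathbb R^3}\rho(x)\,dx$ is finite. -/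

import Mathlib

open MeasureTheory Filter Topology Asymptotics

noncomputable section

/-- Position space and velocity space `ℝ³`, with the Euclidean norm. -/
abbrev R3 : Type := EuclideanSpace ℝ (Fin 3)

/-- The square `L(x, v) = |x × v|²` of the angular momentum. -/
def angularMomentumSq (x v : R3) : ℝ :=
  crossProduct x.ofLp v.ofLp ⬝ᵥ crossProduct x.ofLp v.ofLp

/-- The Newtonian particle energy `E(x, v) = |v|² / 2 + U(|x|)`. -/
def newtonianEnergy (U : ℝ → ℝ) (x v : R3) : ℝ :=
  ‖v‖ ^ 2 / 2 + U ‖x‖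

/-- The relativistic particle energy `E(x, v) = exp(μ(|x|)) √(1 + |v|²)`. -/
def relativisticEnergy (mu : ℝ → ℝ) (x v : R3) : ℝ :=
  Real.exp (mu ‖x‖) * Real.sqrt (1 + ‖v‖ ^ 2)

/-- The assumptions on the profile `φ`, regarded as a function on the energy range `D`
(all of `ℝ` in the Newtonian case, `]0, ∞[` in the relativistic case): `φ` is measurable and
nonnegative on `D`, it vanishes from the cut-off energy `E0 ∈ D` on, it is essentially bounded on
the compact subsets of `{E ∈ D | E < E0}`, and
`φ(E) = c (E0 - E)^k + O((E0 - E)^(k + δ))` as `E` tends to `E0` from the left.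
Values of `φ` outside `D` are unrestricted. -/
structure AdmissibleProfile (D : Set ℝ) (k E0 c δ : ℝ) (φ : ℝ → ℝ) : Prop where
  cutoff_mem : E0 ∈ D
  measurable : Measurable (fun E : D => φ E)
  nonneg : ∀ E ∈ D, 0 ≤ φ E
  eq_zero : ∀ E ∈ D, E0 ≤ E → φ E = 0
  locallyBounded : ∀ K : Set ℝ, IsCompact K → K ⊆ D ∩ Set.Iio E0 →
    MemLp φ ⊤ (volume.restrict K)
  expansion : (fun E : ℝ => φ E - c * (E0 - E) ^ k) =O[𝓝[<] E0]
    (fun E : ℝ => (E0 - E) ^ (k + δ))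

/-- `(f, U)` is a spherically symmetric steady state of the Vlasov-Poisson system with
`f = φ(E) L^l`; `ρ` is the spatial mass density, as a function of the radius. -/
structure IsVlasovPoissonSteadyState (φ : ℝ → ℝ) (l : ℝ) (f : R3 → R3 → ℝ) (U ρ : ℝ → ℝ) :
    Prop where
  ansatz : ∀ x v : R3, f x v = φ (newtonianEnergy U x v) * angularMomentumSq x v ^ l
  density : ∀ x : R3, ρ ‖x‖ = ∫ v : R3, f x v
  potential_C1 : ContDiffOn ℝ 1 U (Set.Ici 0)
  poisson : ∀ r : ℝ, 0 < r →
    deriv U r = 4 * Real.pi / r ^ 2 * ∫ s in (0 : ℝ)..r, s ^ 2 * ρ s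

/-- `(f, λ, μ)` is a static spherically symmetric solution of the Vlasov-Einstein system with
`f = φ(E) L^l`; `ρ` is the mass-energy density and `p` the radial pressure, as functions of the
radius. -/
structure IsVlasovEinsteinSteadyState (φ : ℝ → ℝ) (l : ℝ) (f : R3 → R3 → ℝ)
    (lam mu ρ p : ℝ → ℝ) : Prop where
  ansatz : ∀ x v : R3, f x v = φ (relativisticEnergy mu x v) * angularMomentumSq x v ^ l
  density : ∀ x : R3, ρ ‖x‖ = ∫ v : R3, Real.sqrt (1 + ‖v‖ ^ 2) * f x v
  pressure : ∀ x : R3,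
    p ‖x‖ = ∫ v : R3, (inner ℝ x v / ‖x‖) ^ 2 * f x v / Real.sqrt (1 + ‖v‖ ^ 2)
  lam_C1 : ContDiffOn ℝ 1 lam (Set.Ici 0)
  mu_C1 : ContDiffOn ℝ 1 mu (Set.Ici 0)
  field1 : ∀ r : ℝ, 0 < r →
    Real.exp (-2 * lam r) * (2 * r * deriv lam r - 1) + 1 = 8 * Real.pi * r ^ 2 * ρ r
  field2 : ∀ r : ℝ, 0 < r →
    Real.exp (-2 * lam r) * (2 * r * deriv mu r + 1) - 1 = 8 * Real.pi * r ^ 2 * p r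

/-- The total mass `∫ ρ dx` in the Newtonian case, where `ρ(x) = ∫ f(x, v) dv`. -/
def newtonianMass (f : R3 → R3 → ℝ) : ENNReal :=
  ∫⁻ x : R3, ∫⁻ v : R3, ENNReal.ofReal (f x v)

/-- The total ADM mass `∫ ρ dx` in the relativistic case, where
`ρ(x) = ∫ √(1 + |v|²) f(x, v) dv`. -/
def admMass (f : R3 → R3 → ℝ) : ENNReal :=
  ∫⁻ x : R3, ∫⁻ v : R3, ENNReal.ofReal (Real.sqrt (1 + ‖v‖ ^ 2) * f x v)

end

/-!
Both parts say that the potential well, measured from the cut-off energy `E0`, ends at a finite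
radius. Let `y` be its depth, `y = E0 - U` in the Newtonian and `y = log E0 - μ` in the relativistic
case: no matter is present where `y ≤ 0`, and `y` is nonincreasing, so it suffices to find one
radius with `y ≤ 0`. Compactness of the support and finiteness of the mass then follow from bounds
on a ball.

Carrying out the velocity integral (`lintegral_radial_mul_angularMomentumSq` and a substitution)
gives a density `r ^ (2 l)` times a function of `y` that is comparable to the Abel-type integral
`depthIntegral`, which behaves like a constant times `y ^ (k + l + 3 / 2)` as `y → 0`
(`RegularProfile.tendsto_depthIntegral`). Hence the mass function satisfies
`m' ~ C r ^ (a - 1) y ^ n` with `a = 2 l + 3` and `n = k + l + 3 / 2`, while `-y' ≥ m / r²`, with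
equality up to a factor close to `1` and a small multiple of `m' / r`. The hypotheses on `k` and `l`
are precisely `a > 2` and `1 < n < a`, together with `k > -1`, which makes the profile integrable.

Suppose `y > 0` for all `r`. Then `m ≤ r y` (`mass_le_radius_mul_depth`), and `y → 0`
(`depth_tendsto_zero`). In the homology-invariant variables `x = m / (r y)` and
`ζ = C r ^ a y ^ n / m` the equations become, with `' = r d/dr` and up to vanishing errors,
`x' ≥ x (x - 1 + ζ)` and `ζ' ≥ ζ (a - n x - ζ)`. The bound `x ≤ 1` confines the orbit to a strip,
which it has to leave when `1 ≤ n < a` (`no_orbit_in_strip`); the contradiction is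
`no_global_positive_depth`. Only the asymptotics of the density enters, not its derivative.
-/

/-! ### Orbits of the homology-invariant system -/

theorem false_of_bounded_of_exponential_growth {f f' : ℝ → ℝ} {T η B : ℝ} (hη : 0 < η)
    (hd : ∀ t, T ≤ t → HasDerivAt f (f' t) t) (hpos : ∀ t, T ≤ t → 0 < f t)
    (hgrow : ∀ t, T ≤ t → η * f t ≤ f' t) (hB : ∀ t, T ≤ t → f t ≤ B) : False := by
  have hcont : ContinuousOn f (Set.Ici T) := fun t ht => (hd t ht).continuousAt.continuousWithinAt
  have hmono : MonotoneOn f (Set.Ici T) := by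
    refine monotoneOn_of_deriv_nonneg (convex_Ici T) hcont ?_ ?_
    · intro t ht
      rw [interior_Ici] at ht
      exact (hd t ht.le).differentiableAt.differentiableWithinAt
    · intro t ht
      rw [interior_Ici] at ht
      rw [(hd t ht.le).deriv]
      exact le_trans (mul_nonneg hη.le (hpos t ht.le).le) (hgrow t ht.le)
  have hb : 0 < η * f T := mul_pos hη (hpos T le_rfl)
  have key : ∀ t, T ≤ t → η * f T * (t - T) ≤ f t - f T := by
    intro t ht
    refine (convex_Ici T).mul_sub_le_image_sub_of_le_deriv hcont ?_ ?_ T Set.self_mem_Ici t ht ht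
    · intro t ht
      rw [interior_Ici] at ht
      exact (hd t ht.le).differentiableAt.differentiableWithinAt
    · intro t ht
      rw [interior_Ici] at ht
      rw [(hd t ht.le).deriv]
      refine le_trans ?_ (hgrow t ht.le)
      have hTt : T ≤ t := le_of_lt ht
      exact mul_le_mul_of_nonneg_left (hmono Set.self_mem_Ici hTt hTt) hη.le
  have hT := hpos T le_rfl
  have hTB := hB T le_rfl
  have h1 : T ≤ T + B / (η * f T) := by
    have : 0 ≤ B / (η * f T) := div_nonneg (by linarith) hb.le
    linarith
  have h2 := key _ h1
  have h3 := hB _ h1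
  have h4 : η * f T * (T + B / (η * f T) - T) = B := by field_simp; ring
  rw [h4] at h2
  linarith

/-- The asymptotic dynamics, in logarithmic radius `t`. Up to errors that vanish as `t → ∞`,
`x' ≥ x (x - 1 + ζ)` and `ζ' ≥ ζ (a - n x - ζ)`. For `1 ≤ n < a` no positive solution stays in the
strip `x ≤ 1`: below the line `x + ζ = 1 + η` the variable `ζ` grows exponentially, so the orbit
has to cross this line; it cannot cross back, and above the line `x` grows exponentially. -/
theorem no_orbit_in_strip {a n T : ℝ} (hn : 1 ≤ n) (hna : n < a) {x x' ζ ζ' : ℝ → ℝ}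
    (hx : ∀ t, T ≤ t → HasDerivAt x (x' t) t) (hζ : ∀ t, T ≤ t → HasDerivAt ζ (ζ' t) t)
    (x_pos : ∀ t, T ≤ t → 0 < x t) (x_le : ∀ t, T ≤ t → x t ≤ 1) (ζ_pos : ∀ t, T ≤ t → 0 < ζ t)
    (h1 : ∀ ε > 0, ∀ᶠ t in atTop, x t * (x t - 1 + (1 - ε) * ζ t) ≤ x' t)
    (h2 : ∀ ε > 0, ∀ᶠ t in atTop, ζ t ≤ 2 → ζ t * (a - n * x t - ζ t - ε) ≤ ζ' t) : False := by
  obtain ⟨η, η_pos, η_le, hη⟩ : ∃ η : ℝ, 0 < η ∧ η ≤ 1 ∧ 3 * η ≤ a - n :=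
    ⟨min 1 ((a - n) / 3), lt_min one_pos (by linarith), min_le_left _ _, by
      have := min_le_right 1 ((a - n) / 3); linarith⟩
  obtain ⟨S, hS⟩ := eventually_atTop.1
    (((h1 (η / 4) (by linarith)).and (h2 η η_pos)).and (eventually_ge_atTop T))
  have hST : ∀ t, S ≤ t → T ≤ t := fun t ht => (hS t ht).2
  -- Below the line `x + ζ = 1 + η` the variable `ζ` grows exponentially.
  have ζ_grow : ∀ t, S ≤ t → x t + ζ t ≤ 1 + η → η * ζ t ≤ ζ' t := by
    intro t ht hw
    have hx0 := x_pos t (hST t ht)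
    have hx1 := x_le t (hST t ht)
    refine le_trans ?_ ((hS t ht).1.2 (by linarith))
    rw [mul_comm]
    refine mul_le_mul_of_nonneg_left ?_ (ζ_pos t (hST t ht)).le
    nlinarith [mul_nonneg (sub_nonneg.2 hn) (sub_nonneg.2 hx1)]
  -- Above it `x` does.
  have x_grow : ∀ t, S ≤ t → 1 + η ≤ x t + ζ t → η / 2 * x t ≤ x' t := by
    intro t ht hw
    have hx0 := x_pos t (hST t ht)
    refine le_trans ?_ (hS t ht).1.1
    rw [mul_comm]
    refine mul_le_mul_of_nonneg_left ?_ hx0.le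
    nlinarith [mul_pos η_pos hx0, mul_le_mul_of_nonneg_left η_le η_pos.le,
      mul_le_mul_of_nonneg_left hw (by linarith : (0:ℝ) ≤ 1 - η / 4)]
  obtain ⟨t₁, ht₁, hw₁⟩ : ∃ t, S ≤ t ∧ 1 + η ≤ x t + ζ t := by
    by_contra! hcon
    refine false_of_bounded_of_exponential_growth (f := ζ) (B := 2) η_pos
      (fun t ht => hζ t (hST t ht)) (fun t ht => ζ_pos t (hST t ht))
      (fun t ht => ζ_grow t ht (hcon t ht).le) fun t ht => ?_
    have := hcon t ht
    have := x_pos t (hST t ht)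
    linarith
  -- On the line both variables increase, so it is never crossed downwards.
  have hw : ∀ t, t₁ ≤ t → 1 + η ≤ x t + ζ t := by
    intro t ht
    have hd : ∀ s, t₁ ≤ s → HasDerivAt (fun s => x s + ζ s) (x' s + ζ' s) s := fun s hs =>
      (hx s (hST s (ht₁.trans hs))).add (hζ s (hST s (ht₁.trans hs)))
    refine image_le_of_deriv_right_lt_deriv_boundary' (f := fun _ => 1 + η) (f' := fun _ => 0)
      (B := fun s => x s + ζ s) (B' := fun s => x' s + ζ' s) (a := t₁) (b := t)
      continuousOn_const (fun s _ => hasDerivWithinAt_const _ _ _) hw₁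
      (fun s hs => (hd s hs.1).continuousAt.continuousWithinAt)
      (fun s hs => (hd s hs.1).hasDerivWithinAt) ?_ ⟨ht, le_rfl⟩
    intro s hs heq
    have hsS := ht₁.trans hs.1
    have e1 := x_grow s hsS heq.le
    have e2 := ζ_grow s hsS heq.ge
    have e3 := mul_pos η_pos (x_pos s (hST s hsS))
    have e4 := mul_pos η_pos (ζ_pos s (hST s hsS))
    linarith
  exact false_of_bounded_of_exponential_growth (f := x) (B := 1) (half_pos η_pos)
    (fun t ht => hx t (hST t (ht₁.trans ht))) (fun t ht => x_pos t (hST t (ht₁.trans ht)))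
    (fun t ht => x_grow t (ht₁.trans ht) (hw t ht)) (fun t ht => x_le t (hST t (ht₁.trans ht)))

theorem monotoneOn_Ioi_of_hasDerivAt_nonneg {f f' : ℝ → ℝ} {b : ℝ}
    (hf : ∀ r, b < r → HasDerivAt f (f' r) r) (hf' : ∀ r, b < r → 0 ≤ f' r) :
    MonotoneOn f (Set.Ioi b) := by
  refine monotoneOn_of_deriv_nonneg (convex_Ioi b)
    (fun r hr => (hf r hr).continuousAt.continuousWithinAt) ?_ ?_ <;>
  · intro r hr
    rw [interior_Ioi] at hr
    first
    | exact (hf r hr).differentiableAt.differentiableWithinAt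
    | rw [(hf r hr).deriv]; exact hf' r hr

/-- The mass `m r₀` alone makes the potential drop by `m r₀ / r₀` between `r₀` and infinity; a depth
that stays positive must therefore be at least that large at `r₀`. -/
theorem mass_le_radius_mul_depth {y y' m m' : ℝ → ℝ}
    (hy : ∀ r, 0 < r → HasDerivAt y (y' r) r) (hm : ∀ r, 0 < r → HasDerivAt m (m' r) r)
    (y_pos : ∀ r, 0 < r → 0 < y r)
    (m'_nonneg : ∀ r, 0 < r → 0 ≤ m' r) (hy' : ∀ r, 0 < r → y' r ≤ -(m r / r ^ 2))
    (r₀ : ℝ) (hr₀ : 0 < r₀) : m r₀ ≤ r₀ * y r₀ := by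
  have hmono := monotoneOn_Ioi_of_hasDerivAt_nonneg hm m'_nonneg
  -- `y - m(r₀) / r` is nonincreasing beyond `r₀`, and nonnegative in the limit.
  have hanti : MonotoneOn (fun r => m r₀ * r⁻¹ - y r) (Set.Ici r₀) := by
    have hd : ∀ r, r₀ ≤ r → HasDerivAt (fun r => m r₀ * r⁻¹ - y r)
        (m r₀ * (-(r ^ 2)⁻¹) - y' r) r := fun r hr =>
      ((hasDerivAt_inv (hr₀.trans_le hr).ne').const_mul _).sub (hy r (hr₀.trans_le hr))
    refine monotoneOn_of_deriv_nonneg (convex_Ici r₀)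
      (fun r hr => (hd r hr).continuousAt.continuousWithinAt) ?_ ?_
    · intro r hr
      rw [interior_Ici] at hr
      exact (hd r hr.le).differentiableAt.differentiableWithinAt
    · intro r hr
      rw [interior_Ici] at hr
      rw [(hd r hr.le).deriv]
      have hr0 : 0 < r := hr₀.trans hr
      have h1 := hy' r hr0
      have h2 : m r₀ ≤ m r := hmono hr₀ hr0 hr.le
      have h3 : m r₀ * (r ^ 2)⁻¹ ≤ m r / r ^ 2 := by
        rw [div_eq_mul_inv]
        exact mul_le_mul_of_nonneg_right h2 (by positivity)
      linarith
  have hlim : Tendsto (fun r : ℝ => m r₀ * r⁻¹) atTop (𝓝 (m r₀ * 0)) :=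
    tendsto_inv_atTop_zero.const_mul _
  have h : m r₀ * r₀⁻¹ - y r₀ ≤ m r₀ * 0 := by
    refine ge_of_tendsto hlim ?_
    filter_upwards [eventually_ge_atTop r₀] with r hr
    have h1 : m r₀ * r₀⁻¹ - y r₀ ≤ m r₀ * r⁻¹ - y r := hanti Set.self_mem_Ici hr hr
    have h2 := y_pos r (hr₀.trans_le hr)
    linarith
  have : m r₀ * r₀⁻¹ ≤ y r₀ := by linarith
  calc m r₀ = r₀ * (m r₀ * r₀⁻¹) := by field_simp
    _ ≤ r₀ * y r₀ := mul_le_mul_of_nonneg_left this hr₀.le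

/-- If the density stayed above a multiple of `r ^ (a - 3)`, then `m` would grow like `r ^ a`,
faster than the linear bound of `mass_le_radius_mul_depth` permits. -/
theorem depth_tendsto_zero {a : ℝ} (ha : 2 < a) {y y' m m' : ℝ → ℝ}
    (hy : ∀ r, 0 < r → HasDerivAt y (y' r) r) (hm : ∀ r, 0 < r → HasDerivAt m (m' r) r)
    (y_pos : ∀ r, 0 < r → 0 < y r) (m_nonneg : ∀ r, 0 < r → 0 ≤ m r)
    (m'_nonneg : ∀ r, 0 < r → 0 ≤ m' r) (hy' : ∀ r, 0 < r → y' r ≤ -(m r / r ^ 2))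
    (hdense : ∀ ε > 0, ∃ b > 0, ∀ r, 0 < r → ε ≤ y r → b * r ^ (a - 1) ≤ m' r) :
    Tendsto y atTop (𝓝 0) := by
  have hanti : MonotoneOn (fun r => - y r) (Set.Ioi 0) :=
    monotoneOn_Ioi_of_hasDerivAt_nonneg (fun r hr => (hy r hr).neg) fun r hr => by
      have := hy' r hr
      have : 0 ≤ m r / r ^ 2 := div_nonneg (m_nonneg r hr) (by positivity)
      linarith
  -- It suffices that `y` gets below every `ε`.
  suffices H : ∀ ε > 0, ∃ r, 0 < r ∧ y r < ε by
    rw [Metric.tendsto_atTop]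
    intro ε hε
    obtain ⟨R, hR, hyR⟩ := H ε hε
    refine ⟨R, fun r hr => ?_⟩
    have h1 := hanti hR (hR.trans_le hr) hr
    have h2 := y_pos r (hR.trans_le hr)
    simp only at h1
    rw [Real.dist_eq, sub_zero, abs_of_pos h2]
    linarith
  by_contra! hcon
  obtain ⟨ε, hε, hcon⟩ := hcon
  obtain ⟨b, hb, hdense⟩ := hdense ε hε
  have ha0 : 0 < a := by linarith
  have hgrow : MonotoneOn (fun r => m r - b / a * r ^ a) (Set.Ioi 0) :=
    monotoneOn_Ioi_of_hasDerivAt_nonneg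
      (f' := fun r => m' r - b / a * (a * r ^ (a - 1)))
      (fun r hr => (hm r hr).sub ((Real.hasDerivAt_rpow_const (Or.inl hr.ne')).const_mul _))
      fun r hr => by
        have h1 := hdense r hr (hcon r hr)
        have h2 : b / a * (a * r ^ (a - 1)) = b * r ^ (a - 1) := by field_simp
        linarith
  -- `m ≥ (b / a) (r ^ a - 1)` while `m ≤ r y(1)`: impossible since `a > 2`.
  have hupper : ∀ r, 1 ≤ r → b / a * (r ^ a - 1) ≤ r * y 1 := by
    intro r hr
    have hr0 : 0 < r := by linarith
    have h1 : m 1 - b / a * 1 ^ a ≤ m r - b / a * r ^ a := hgrow (Set.mem_Ioi.2 one_pos) hr0 hr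
    rw [Real.one_rpow] at h1
    have h2 := m_nonneg 1 one_pos
    have h3 := mass_le_radius_mul_depth hy hm y_pos m'_nonneg hy' r hr0
    have h4 : - y 1 ≤ - y r := hanti (Set.mem_Ioi.2 one_pos) hr0 hr
    have h5 : r * y r ≤ r * y 1 := mul_le_mul_of_nonneg_left (by linarith) hr0.le
    linarith
  have hba : 0 < b / a := div_pos hb ha0
  have hy1 := y_pos 1 one_pos
  set r : ℝ := 1 + y 1 / (b / a) + 1 with hr
  have hr1 : 2 ≤ r := by have : 0 < y 1 / (b / a) := by positivity
                         linarith
  have h1 := hupper r (by linarith)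
  have h2 : r ^ 2 ≤ r ^ a := by
    rw [← Real.rpow_natCast]
    exact Real.rpow_le_rpow_of_exponent_le (by linarith) (by exact_mod_cast ha.le)
  have h3 : b / a * r = 2 * (b / a) + y 1 := by rw [hr]; field_simp; ring
  have h4 : b / a * (r ^ 2 - 1) ≤ r * y 1 :=
    le_trans (mul_le_mul_of_nonneg_left (by linarith) hba.le) h1
  nlinarith

/-- A potential well of depth `y > 0` at every radius, generated by a mass function `m` with
`m' ~ C r ^ (a - 1) y ^ n`, is impossible when `1 ≤ n < a` and `a > 2`. The functions `e₁`, `e₂`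
absorb the relativistic corrections to `-y' = m / r²`. The hypotheses on the asymptotic regime
are needed only once `y → 0` is known. -/
theorem no_global_positive_depth {a n C : ℝ} (ha : 2 < a) (hn : 1 ≤ n) (hna : n < a)
    (hC : 0 < C) {y y' m m' e₁ e₂ : ℝ → ℝ}
    (hy : ∀ r, 0 < r → HasDerivAt y (y' r) r) (hm : ∀ r, 0 < r → HasDerivAt m (m' r) r)
    (y_pos : ∀ r, 0 < r → 0 < y r) (m_nonneg : ∀ r, 0 < r → 0 ≤ m r)
    (m'_nonneg : ∀ r, 0 < r → 0 ≤ m' r) (hy' : ∀ r, 0 < r → y' r ≤ -(m r / r ^ 2))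
    (hdense : ∀ ε > 0, ∃ b > 0, ∀ r, 0 < r → ε ≤ y r → b * r ^ (a - 1) ≤ m' r)
    (hasymp : Tendsto y atTop (𝓝 0) →
      Tendsto (fun r => m' r / (r ^ (a - 1) * y r ^ n)) atTop (𝓝 C))
    (he₁ : Tendsto y atTop (𝓝 0) → Tendsto e₁ atTop (𝓝 1))
    (he₂ : Tendsto y atTop (𝓝 0) → Tendsto e₂ atTop (𝓝 0))
    (hy'_lower : Tendsto y atTop (𝓝 0) →
      ∀ᶠ r in atTop, -y' r ≤ e₁ r * (m r / r ^ 2 + e₂ r * (m' r / r))) : False := by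
  have hlim := depth_tendsto_zero ha hy hm y_pos m_nonneg m'_nonneg hy' hdense
  replace hasymp := hasymp hlim
  replace he₁ := he₁ hlim
  replace he₂ := he₂ hlim
  replace hy'_lower := hy'_lower hlim
  have hmono := monotoneOn_Ioi_of_hasDerivAt_nonneg hm m'_nonneg
  have m_pos : ∀ r, 0 < r → 0 < m r := by
    intro r hr
    refine (m_nonneg r hr).lt_of_ne fun h0 => ?_
    -- Otherwise `m = 0` on `]0, r]`, so that `m' = 0` at `r / 2`.
    have hz : ∀ s, 0 < s → s ≤ r → m s = 0 := fun s hs hsr =>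
      le_antisymm (h0 ▸ hmono hs hr hsr) (m_nonneg s hs)
    have hr2 : 0 < r / 2 := half_pos hr
    have hev : m =ᶠ[𝓝 (r / 2)] fun _ => 0 := by
      filter_upwards [Ioo_mem_nhds hr2 (half_lt_self hr)] with s hs
      exact hz s hs.1 hs.2.le
    have hm0 : m' (r / 2) = 0 :=
      (hm _ hr2).unique ((hasDerivAt_const _ _).congr_of_eventuallyEq hev)
    obtain ⟨b, hb, hb'⟩ := hdense _ (y_pos _ hr2)
    have h1 := hb' _ hr2 le_rfl
    have h2 : 0 < (r / 2) ^ (a - 1) := Real.rpow_pos_of_pos hr2 _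
    have h3 := mul_pos hb h2
    linarith
  have key : ∀ r, 0 < r → m r ≤ r * y r :=
    mass_le_radius_mul_depth hy hm y_pos m'_nonneg hy'
  -- The homology-invariant variables; `ζ` is the leading term of `r m' / m`.
  set x : ℝ → ℝ := fun r => m r / (r * y r) with hx_def
  set ζ : ℝ → ℝ := fun r => C * (r ^ a * y r ^ n) / m r with hζ_def
  have hxd : ∀ r, 0 < r → HasDerivAt x ((m' r * (r * y r) - m r * (1 * y r + r * y' r)) /
      (r * y r) ^ 2) r := fun r hr =>
    (hm r hr).div ((hasDerivAt_id r).mul (hy r hr)) (mul_pos hr (y_pos r hr)).ne'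
  have hζd : ∀ r, 0 < r → HasDerivAt ζ ((C * (a * r ^ (a - 1) * y r ^ n +
      r ^ a * (y' r * n * y r ^ (n - 1))) * m r - C * (r ^ a * y r ^ n) * m' r) / m r ^ 2) r :=
    fun r hr => (((Real.hasDerivAt_rpow_const (Or.inl hr.ne')).mul
      ((hy r hr).rpow_const (Or.inl (y_pos r hr).ne'))).const_mul C).div (hm r hr) (m_pos r hr).ne'
  have x_pos : ∀ r, 0 < r → 0 < x r := fun r hr =>
    div_pos (m_pos r hr) (mul_pos hr (y_pos r hr))
  have x_le : ∀ r, 0 < r → x r ≤ 1 := fun r hr =>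
    (div_le_one (mul_pos hr (y_pos r hr))).2 (key r hr)
  have ζ_pos : ∀ r, 0 < r → 0 < ζ r := fun r hr => by
    have := m_pos r hr
    have := Real.rpow_pos_of_pos hr a
    have := Real.rpow_pos_of_pos (y_pos r hr) n
    positivity
  have hxlog : ∀ r, 0 < r → r * ((m' r * (r * y r) - m r * (1 * y r + r * y' r)) /
      (r * y r) ^ 2) = x r * (r * m' r / m r - 1 - r * y' r / y r) := by
    intro r hr
    have := m_pos r hr
    have := y_pos r hr
    simp only [hx_def]
    field_simp
    ring
  have hζlog : ∀ r, 0 < r → r * ((C * (a * r ^ (a - 1) * y r ^ n +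
      r ^ a * (y' r * n * y r ^ (n - 1))) * m r - C * (r ^ a * y r ^ n) * m' r) / m r ^ 2) =
      ζ r * (a + n * (r * y' r / y r) - r * m' r / m r) := by
    intro r hr
    have := m_pos r hr
    have := y_pos r hr
    simp only [hζ_def]
    rw [Real.rpow_sub_one hr.ne', Real.rpow_sub_one this.ne']
    field_simp
  -- `r m' / m` is `ζ` up to a factor close to `1`.
  have hz : ∀ r, 0 < r → r * m' r / m r = m' r / (r ^ (a - 1) * y r ^ n) / C * ζ r := by
    intro r hr
    have := m_pos r hr
    have h1 := Real.rpow_pos_of_pos hr a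
    have h2 := Real.rpow_pos_of_pos (y_pos r hr) n
    simp only [hζ_def]
    rw [Real.rpow_sub_one hr.ne']
    field_simp
  have hratio : Tendsto (fun r => m' r / (r ^ (a - 1) * y r ^ n) / C) atTop (𝓝 1) := by
    simpa [hC.ne'] using hasymp.div_const C
  -- The logarithmic derivative of `y` dominates `x`.
  have hP : ∀ r, 0 < r → x r ≤ -(r * y' r / y r) := by
    intro r hr
    have h1 := hy' r hr
    have h2 := y_pos r hr
    have : x r = r * (m r / r ^ 2) / y r := by simp only [hx_def]; field_simp
    rw [this, ← neg_div, div_le_div_iff_of_pos_right h2, ← mul_neg]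
    exact mul_le_mul_of_nonneg_left (by linarith) hr.le
  refine no_orbit_in_strip (T := 0) hn hna (x := fun t => x (Real.exp t))
    (ζ := fun t => ζ (Real.exp t))
    (fun t _ => (hxd _ (Real.exp_pos t)).comp t (Real.hasDerivAt_exp t))
    (fun t _ => (hζd _ (Real.exp_pos t)).comp t (Real.hasDerivAt_exp t))
    (fun t _ => x_pos _ (Real.exp_pos t)) (fun t _ => x_le _ (Real.exp_pos t))
    (fun t _ => ζ_pos _ (Real.exp_pos t)) ?_ ?_
  · intro ε hε
    refine Real.tendsto_exp_atTop.eventually (p := fun r => x r * (x r - 1 + (1 - ε) * ζ r) ≤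
      ((m' r * (r * y r) - m r * (1 * y r + r * y' r)) / (r * y r) ^ 2) * r) ?_
    filter_upwards [hratio.eventually (lt_mem_nhds (by linarith : 1 - ε < 1)),
      eventually_gt_atTop 0] with r hr hr0
    rw [mul_comm _ r, hxlog r hr0]
    refine mul_le_mul_of_nonneg_left ?_ (x_pos r hr0).le
    have h1 : (1 - ε) * ζ r ≤ r * m' r / m r := by
      rw [hz r hr0]
      exact mul_le_mul_of_nonneg_right hr.le (ζ_pos r hr0).le
    have h2 := hP r hr0
    linarith
  · intro ε hε
    refine Real.tendsto_exp_atTop.eventually (p := fun r => ζ r ≤ 2 →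
      ζ r * (a - n * x r - ζ r - ε) ≤ ((C * (a * r ^ (a - 1) * y r ^ n +
      r ^ a * (y' r * n * y r ^ (n - 1))) * m r - C * (r ^ a * y r ^ n) * m' r) / m r ^ 2) * r) ?_
    have hE : Tendsto (fun r => e₁ r * (1 + |e₂ r| * 3)) atTop (𝓝 1) := by
      simpa using he₁.mul ((he₂.abs.mul_const 3).const_add 1)
    have hn0 : 0 < n := by linarith
    filter_upwards [hratio.eventually (gt_mem_nhds (by linarith : 1 < 1 + ε / 4)),
      hratio.eventually (gt_mem_nhds (by norm_num : (1 : ℝ) < 3 / 2)),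
      hE.eventually (gt_mem_nhds (by linarith [div_pos hε (mul_pos two_pos hn0)] :
        1 < 1 + ε / (2 * n))), he₁.eventually (lt_mem_nhds (by norm_num : (0 : ℝ) < 1)),
      hy'_lower, eventually_gt_atTop 0] with r h1 h1' h2 h2' h3 hr0 hζ2
    rw [mul_comm _ r, hζlog r hr0]
    refine mul_le_mul_of_nonneg_left ?_ (ζ_pos r hr0).le
    have hy0 := y_pos r hr0
    have hx0 := x_pos r hr0
    have hζ0 := ζ_pos r hr0
    have hm0 := m_pos r hr0
    have hz1 : r * m' r / m r ≤ ζ r + ε / 2 := by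
      rw [hz r hr0]
      have := mul_le_mul_of_nonneg_right h1.le hζ0.le
      nlinarith
    have hz3 : r * m' r / m r ≤ 3 := by
      rw [hz r hr0]
      have := mul_le_mul_of_nonneg_right h1'.le hζ0.le
      linarith
    have hz0 : 0 ≤ r * m' r / m r := div_nonneg (mul_nonneg hr0.le (m'_nonneg r hr0)) hm0.le
    have hPu : -(r * y' r / y r) ≤ x r * (1 + ε / (2 * n)) := by
      calc -(r * y' r / y r) = r / y r * (-y' r) := by ring
        _ ≤ r / y r * (e₁ r * (m r / r ^ 2 + e₂ r * (m' r / r))) :=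
            mul_le_mul_of_nonneg_left h3 (by positivity)
        _ = x r * (e₁ r * (1 + e₂ r * (r * m' r / m r))) := by
            simp only [hx_def]; field_simp
        _ ≤ x r * (e₁ r * (1 + |e₂ r| * 3)) := by
            have : e₂ r * (r * m' r / m r) ≤ |e₂ r| * 3 :=
              le_trans (mul_le_mul_of_nonneg_right (le_abs_self _) hz0)
                (mul_le_mul_of_nonneg_left hz3 (abs_nonneg _))
            gcongr
        _ ≤ _ := by gcongr
    have h4 : n * (x r * (1 + ε / (2 * n))) = n * x r + ε / 2 * x r := by field_simp
    have h5 : ε / 2 * x r ≤ ε / 2 := by nlinarith [x_le r hr0]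
    nlinarith [mul_le_mul_of_nonneg_left hPu hn0.le]

/-! ### Energy profiles and the Abel-type integral -/

/-- The properties of an energy profile that the argument uses, in terms of the variable
`Φ τ = φ (E0 - A τ)`, which measures the distance to the cut-off energy in units of `A`:
`Φ ≥ 0` vanishes for `τ ≤ 0`, is integrable up to every `Y ∈ S`, and `Φ τ = (C + o(1)) τ ^ k` as
`τ → 0+`. The set `S` consists of the `Y` for which `E0 - A Y` is an energy in the domain of `φ`. -/
structure RegularProfile (S : Set ℝ) (k C : ℝ) (Φ : ℝ → ℝ) : Prop where
  measurable : Measurable Φ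
  nonneg : ∀ τ, 0 ≤ Φ τ
  eq_zero : ∀ τ, τ ≤ 0 → Φ τ = 0
  exists_pos_mem : ∃ Y ∈ S, 0 < Y
  integrableOn : ∀ Y ∈ S, IntegrableOn Φ (Set.Iic Y)
  asymptotics : ∀ ε > 0, ∀ᶠ τ in 𝓝[>] (0 : ℝ), |Φ τ - C * τ ^ k| ≤ ε * τ ^ k

/-- Outside its domain `D` the profile is unrestricted, hence possibly not measurable; it is
replaced by `0` there. -/
theorem AdmissibleProfile.regularProfile {D : Set ℝ} {k E0 c δ A : ℝ} {φ : ℝ → ℝ}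
    (h : AdmissibleProfile D k E0 c δ φ) (hD : IsOpen D) (hDup : IsUpperSet D) (hk : -1 < k)
    (hδ : 0 < δ) (hA : 0 < A) :
    RegularProfile {Y | E0 - A * Y ∈ D} k (c * A ^ k)
      (fun τ => D.indicator φ (E0 - A * τ)) := by
  have hmeas : Measurable (D.indicator φ) := by
    refine measurable_of_restrict_of_restrict_compl hD.measurableSet ?_ ?_
    · convert h.measurable using 1
      ext ⟨x, hx⟩
      simp [hx]
    · convert (measurable_const : Measurable fun _ : ↥Dᶜ => (0 : ℝ)) using 1
      ext ⟨x, hx⟩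
      simp [show x ∉ D from hx]
  have hzero : ∀ τ, τ ≤ 0 → D.indicator φ (E0 - A * τ) = 0 := by
    intro τ hτ
    have h1 : E0 ≤ E0 - A * τ := by nlinarith
    rw [Set.indicator_of_mem (hDup h1 h.cutoff_mem)]
    exact h.eq_zero _ (hDup h1 h.cutoff_mem) h1
  have hshift : Tendsto (fun τ : ℝ => E0 - A * τ) (𝓝[>] 0) (𝓝[<] E0) := by
    refine tendsto_nhdsWithin_iff.2 ⟨?_, ?_⟩
    · have : Continuous fun τ : ℝ => E0 - A * τ := by fun_prop
      simpa using (this.tendsto 0).mono_left nhdsWithin_le_nhds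
    · filter_upwards [self_mem_nhdsWithin] with τ hτ
      have : 0 < A * τ := mul_pos hA hτ
      simp only [Set.mem_Iio]
      linarith
  have hasymp : ∀ ε > 0, ∀ᶠ τ in 𝓝[>] (0 : ℝ),
      |D.indicator φ (E0 - A * τ) - c * A ^ k * τ ^ k| ≤ ε * τ ^ k := by
    intro ε hε
    obtain ⟨M, hM⟩ := (h.expansion.comp_tendsto hshift).bound
    have hpow : Tendsto (fun τ : ℝ => M * A ^ (k + δ) * τ ^ δ) (𝓝[>] 0) (𝓝 0) := by
      have : ContinuousAt (fun τ : ℝ => M * A ^ (k + δ) * τ ^ δ) 0 :=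
        (Real.continuousAt_rpow_const 0 δ (Or.inr hδ.le)).const_mul _
      simpa [ContinuousAt, Real.zero_rpow hδ.ne'] using this.tendsto.mono_left nhdsWithin_le_nhds
    have hmem : ∀ᶠ τ in 𝓝[>] (0 : ℝ), E0 - A * τ ∈ D :=
      (hshift.mono_right nhdsWithin_le_nhds).eventually (hD.mem_nhds h.cutoff_mem)
    filter_upwards [hM, hpow.eventually (gt_mem_nhds hε), hmem, self_mem_nhdsWithin]
      with τ h1 h2 h3 h4
    have hτ : 0 < τ := h4
    rw [Set.indicator_of_mem h3]
    simp only [Function.comp, sub_sub_cancel, Real.norm_eq_abs] at h1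
    rw [Real.mul_rpow hA.le hτ.le, Real.mul_rpow hA.le hτ.le,
      abs_of_nonneg (mul_nonneg (Real.rpow_nonneg hA.le _) (Real.rpow_nonneg hτ.le _)),
      Real.rpow_add hτ] at h1
    rw [mul_assoc c]
    have h5 := Real.rpow_pos_of_pos hτ k
    calc _ ≤ _ := h1
      _ = M * A ^ (k + δ) * τ ^ δ * τ ^ k := by ring
      _ ≤ ε * τ ^ k := mul_le_mul_of_nonneg_right h2.le h5.le
  refine ⟨?_, ?_, hzero, ?_, ?_, hasymp⟩
  · exact hmeas.comp (by fun_prop)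
  · intro τ
    exact Set.indicator_nonneg h.nonneg _
  · have hmem : ∀ᶠ τ in 𝓝[>] (0 : ℝ), E0 - A * τ ∈ D :=
      (hshift.mono_right nhdsWithin_le_nhds).eventually (hD.mem_nhds h.cutoff_mem)
    obtain ⟨Y, hY, hY0⟩ := (hmem.and self_mem_nhdsWithin).exists
    exact ⟨Y, hY, hY0⟩
  · intro Y hY
    set Φ : ℝ → ℝ := fun τ => D.indicator φ (E0 - A * τ) with hΦ
    have hΦm : Measurable Φ := hmeas.comp (by fun_prop)
    obtain ⟨t, ht, hbd⟩ := mem_nhdsGT_iff_exists_Ioc_subset.1 (hasymp 1 one_pos)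
    have ht0 : (0 : ℝ) < t := ht
    have I1 : IntegrableOn Φ (Set.Iic 0) :=
      (integrableOn_zero).congr_fun (fun τ hτ => (hzero τ hτ).symm) measurableSet_Iic
    have I2 : IntegrableOn Φ (Set.Ioc 0 t) := by
      have hpow : IntegrableOn (fun τ : ℝ => (|c * A ^ k| + 1) * τ ^ k) (Set.Ioc 0 t) := by
        have := (intervalIntegral.intervalIntegrable_rpow' hk (a := 0) (b := t)).const_mul
          (|c * A ^ k| + 1)
        rwa [intervalIntegrable_iff_integrableOn_Ioc_of_le ht0.le] at this
      refine Integrable.mono' hpow hΦm.aestronglyMeasurable ?_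
      filter_upwards [ae_restrict_mem measurableSet_Ioc] with τ hτ
      have h1 : |Φ τ - c * A ^ k * τ ^ k| ≤ 1 * τ ^ k := hbd hτ
      have h2 := Real.rpow_nonneg hτ.1.le k
      have h3 : |c * A ^ k * τ ^ k| = |c * A ^ k| * τ ^ k := by
        rw [abs_mul, abs_of_nonneg h2]
      rw [Real.norm_eq_abs]
      have h4 := abs_sub_abs_le_abs_sub (Φ τ) (c * A ^ k * τ ^ k)
      linarith
    have I3 : IntegrableOn Φ (Set.Icc t Y) := by
      have hKD : Set.Icc (E0 - A * Y) (E0 - A * t) ⊆ D ∩ Set.Iio E0 := by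
        intro E hE
        refine ⟨hDup hE.1 hY, ?_⟩
        have : 0 < A * t := mul_pos hA ht0
        simp only [Set.mem_Iio]
        linarith [hE.2]
      have hL := h.locallyBounded _ isCompact_Icc hKD
      have : IsFiniteMeasure (volume.restrict (Set.Icc (E0 - A * Y) (E0 - A * t))) :=
        ⟨by simp⟩
      have hI : IntegrableOn φ (Set.Icc (E0 - A * Y) (E0 - A * t)) :=
        hL.integrable le_top
      have hI2 := ((integrable_indicator_iff measurableSet_Icc).2 hI).comp_sub_left E0
      have hI3 := hI2.comp_mul_left' hA.ne'
      refine (hI3.integrableOn (s := Set.Icc t Y)).congr_fun (fun τ hτ => ?_) measurableSet_Icc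
      have hmem : E0 - A * τ ∈ Set.Icc (E0 - A * Y) (E0 - A * t) := by
        constructor <;> nlinarith [hτ.1, hτ.2]
      simp only [hΦ]
      rw [Set.indicator_of_mem hmem, Set.indicator_of_mem (hKD hmem).1]
    refine ((I1.union I2).union I3).mono_set fun τ hτ => ?_
    rcases le_or_gt τ 0 with h0 | h0
    · exact Or.inl (Or.inl h0)
    · rcases le_or_gt τ t with h1 | h1
      · exact Or.inl (Or.inr ⟨h0, h1⟩)
      · exact Or.inr ⟨h1.le, hτ⟩

/-- The Abel-type integral `∫ Φ(τ) (y - τ)₊ ^ q dτ`. With `q = l + 1 / 2` it is, up to a constant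
and the factor `r ^ (2 l)`, the density at a point where the potential well has depth `y`.
For `q > 0` the integrand vanishes for `τ ≥ y`, because `0 ^ q = 0`. -/
noncomputable def depthIntegral (Φ : ℝ → ℝ) (q y : ℝ) : ℝ :=
  ∫ τ, Φ τ * max (y - τ) 0 ^ q

namespace RegularProfile

variable {S : Set ℝ} {k C q : ℝ} {Φ : ℝ → ℝ}

theorem measurable_integrand (h : RegularProfile S k C Φ) (q y : ℝ) :
    Measurable fun τ => Φ τ * max (y - τ) 0 ^ q :=
  h.measurable.mul (((measurable_const.sub measurable_id).max measurable_const).pow_const q)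

theorem integrand_nonneg (h : RegularProfile S k C Φ) (q y τ : ℝ) :
    0 ≤ Φ τ * max (y - τ) 0 ^ q :=
  mul_nonneg (h.nonneg τ) (Real.rpow_nonneg (le_max_right _ _) _)

theorem integrand_le (h : RegularProfile S k C Φ) (hq : 0 < q) {y Y : ℝ} (hyY : y ≤ Y) (τ : ℝ) :
    Φ τ * max (y - τ) 0 ^ q ≤ (Set.Iic Y).indicator Φ τ * max Y 0 ^ q := by
  rcases le_or_gt τ 0 with h0 | h0
  · simp [Set.indicator_apply, h.eq_zero τ h0]
  · by_cases h1 : τ ≤ Y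
    · rw [Set.indicator_of_mem (show τ ∈ Set.Iic Y from h1)]
      refine mul_le_mul_of_nonneg_left ?_ (h.nonneg τ)
      exact Real.rpow_le_rpow (le_max_right _ _) (max_le_max (by linarith) le_rfl) hq.le
    · rw [Set.indicator_of_notMem (show τ ∉ Set.Iic Y from h1), max_eq_right (by linarith),
        Real.zero_rpow hq.ne']
      simp

theorem integrable_bound (h : RegularProfile S k C Φ) (q : ℝ) {Y : ℝ} (hY : Y ∈ S) :
    Integrable fun τ => (Set.Iic Y).indicator Φ τ * max Y 0 ^ q :=
  ((integrable_indicator_iff measurableSet_Iic).2 (h.integrableOn Y hY)).mul_const _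

theorem integrable_integrand (h : RegularProfile S k C Φ) (hq : 0 < q) {y Y : ℝ}
    (hY : Y ∈ S) (hyY : y ≤ Y) : Integrable fun τ => Φ τ * max (y - τ) 0 ^ q :=
  (h.integrable_bound q hY).mono' (h.measurable_integrand q y).aestronglyMeasurable
    (Eventually.of_forall fun τ => by
      rw [Real.norm_of_nonneg (h.integrand_nonneg q y τ)]
      exact h.integrand_le hq hyY τ)

theorem lintegral_eq_ofReal_depthIntegral (h : RegularProfile S k C Φ) (hq : 0 < q) {y : ℝ}
    (hy : y ∈ S) : ∫⁻ τ, ENNReal.ofReal (Φ τ * max (y - τ) 0 ^ q) =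
      ENNReal.ofReal (depthIntegral Φ q y) :=
  (ofReal_integral_eq_lintegral_ofReal (h.integrable_integrand hq hy le_rfl)
    (Eventually.of_forall (h.integrand_nonneg q y))).symm

theorem depthIntegral_nonneg (h : RegularProfile S k C Φ) (q y : ℝ) : 0 ≤ depthIntegral Φ q y :=
  integral_nonneg (h.integrand_nonneg q y)

theorem depthIntegral_mono (h : RegularProfile S k C Φ) (hq : 0 < q) {y Y : ℝ}
    (hY : Y ∈ S) (hyY : y ≤ Y) : depthIntegral Φ q y ≤ depthIntegral Φ q Y := by
  refine integral_mono (h.integrable_integrand hq hY hyY) (h.integrable_integrand hq hY le_rfl)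
    fun τ => ?_
  refine mul_le_mul_of_nonneg_left ?_ (h.nonneg τ)
  exact Real.rpow_le_rpow (le_max_right _ _) (max_le_max (by linarith) le_rfl) hq.le

theorem continuousAt_depthIntegral (h : RegularProfile S k C Φ) (hq : 0 < q) {y Y : ℝ}
    (hY : Y ∈ S) (hyY : y < Y) : ContinuousAt (depthIntegral Φ q) y := by
  refine continuousAt_of_dominated (bound := fun τ => (Set.Iic Y).indicator Φ τ * max Y 0 ^ q)
    (Eventually.of_forall fun z => (h.measurable_integrand q z).aestronglyMeasurable) ?_
    (h.integrable_bound q hY) (Eventually.of_forall fun τ => ?_)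
  · filter_upwards [gt_mem_nhds hyY] with z hz
    refine Eventually.of_forall fun τ => ?_
    rw [Real.norm_of_nonneg (h.integrand_nonneg q z τ)]
    exact h.integrand_le hq (le_of_lt hz) τ
  · have : Continuous fun z : ℝ => Φ τ * max (z - τ) 0 ^ q :=
      continuous_const.mul (((continuous_id.sub continuous_const).max continuous_const).rpow_const
        fun _ => Or.inr hq.le)
    exact this.continuousAt

end RegularProfile

theorem intervalIntegrable_rpow_mul_sub_rpow {k q : ℝ} (hk : -1 < k) (hq : 0 < q) (y : ℝ) :
    IntervalIntegrable (fun τ => τ ^ k * (y - τ) ^ q) volume 0 y := by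
  refine (intervalIntegral.intervalIntegrable_rpow' hk).mul_continuousOn ?_
  exact Continuous.continuousOn ((continuous_const.sub continuous_id).rpow_const
    fun _ => Or.inr hq.le)

theorem integral_rpow_mul_sub_rpow {k q y : ℝ} (hy : 0 < y) :
    ∫ τ in (0 : ℝ)..y, τ ^ k * (y - τ) ^ q =
      y ^ (k + q + 1) * ∫ σ in (0 : ℝ)..1, σ ^ k * (1 - σ) ^ q := by
  have h1 := intervalIntegral.mul_integral_comp_mul_left (a := 0) (b := 1)
    (f := fun τ => τ ^ k * (y - τ) ^ q) y
  rw [mul_zero, mul_one] at h1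
  rw [← h1, Real.rpow_add hy, Real.rpow_one, mul_comm _ y, mul_assoc]
  congr 1
  rw [← intervalIntegral.integral_const_mul]
  refine intervalIntegral.integral_congr fun σ hσ => ?_
  rw [Set.uIcc_of_le zero_le_one] at hσ
  have h2 : y - y * σ = y * (1 - σ) := by ring
  rw [h2, Real.mul_rpow hy.le hσ.1, Real.mul_rpow hy.le (by linarith [hσ.2]), Real.rpow_add hy]
  ring

theorem integral_rpow_mul_one_sub_rpow_pos {k q : ℝ} (hk : -1 < k) (hq : 0 < q) :
    0 < ∫ σ in (0 : ℝ)..1, σ ^ k * (1 - σ) ^ q := by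
  refine intervalIntegral.intervalIntegral_pos_of_pos_on
    (intervalIntegrable_rpow_mul_sub_rpow hk hq 1) (fun σ hσ => ?_) one_pos
  exact mul_pos (Real.rpow_pos_of_pos hσ.1 _) (Real.rpow_pos_of_pos (by linarith [hσ.2]) _)

namespace RegularProfile

variable {S : Set ℝ} {k C q : ℝ} {Φ : ℝ → ℝ}

theorem depthIntegral_eq_intervalIntegral (h : RegularProfile S k C Φ) (hq : 0 < q) {y : ℝ}
    (hy : 0 ≤ y) : depthIntegral Φ q y = ∫ τ in (0 : ℝ)..y, Φ τ * (y - τ) ^ q := by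
  rw [intervalIntegral.integral_of_le hy, depthIntegral,
    ← setIntegral_eq_integral_of_forall_compl_eq_zero (s := Set.Ioc 0 y)]
  · refine setIntegral_congr_fun measurableSet_Ioc fun τ hτ => ?_
    rw [max_eq_left (by linarith [hτ.2])]
  · intro τ hτ
    rcases le_or_gt τ 0 with h0 | h0
    · rw [h.eq_zero τ h0, zero_mul]
    · have : y < τ := lt_of_not_ge fun h1 => hτ ⟨h0, h1⟩
      rw [max_eq_right (by linarith), Real.zero_rpow hq.ne', mul_zero]

/-- Since `Φ τ ~ C τ ^ k`, scaling `τ = y σ` shows that the integral behaves like `y ^ (k + q + 1)`,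
the factor being `C` times a Beta integral. -/
theorem tendsto_depthIntegral (h : RegularProfile S k C Φ) (hk : -1 < k) (hq : 0 < q) :
    Tendsto (fun y => depthIntegral Φ q y / y ^ (k + q + 1)) (𝓝[>] 0)
      (𝓝 (C * ∫ σ in (0 : ℝ)..1, σ ^ k * (1 - σ) ^ q)) := by
  set B := ∫ σ in (0 : ℝ)..1, σ ^ k * (1 - σ) ^ q with hB
  have hBpos : 0 < B := integral_rpow_mul_one_sub_rpow_pos hk hq
  obtain ⟨Y, hYS, hY⟩ := h.exists_pos_mem
  rw [Metric.tendsto_nhds]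
  intro ε hε
  set ε' := ε / (2 * B) with hε'
  have hε'0 : 0 < ε' := by positivity
  obtain ⟨t, ht, hbd⟩ := mem_nhdsGT_iff_exists_Ioc_subset.1 (h.asymptotics ε' hε'0)
  have ht0 : (0 : ℝ) < t := ht
  filter_upwards [Ioc_mem_nhdsGT ht0, Ioc_mem_nhdsGT hY] with y hyt hyY
  have hy : 0 < y := hyt.1
  have hyn := Real.rpow_pos_of_pos hy (k + q + 1)
  have hI : IntervalIntegrable (fun τ => Φ τ * (y - τ) ^ q) volume 0 y := by
    rw [intervalIntegrable_iff_integrableOn_Ioc_of_le hy.le]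
    refine ((h.integrable_integrand hq hYS hyY.2).integrableOn).congr_fun (fun τ hτ => ?_)
      measurableSet_Ioc
    simp only
    rw [max_eq_left (by linarith [hτ.2])]
  have hI' := intervalIntegrable_rpow_mul_sub_rpow hk hq y
  have hdiff : depthIntegral Φ q y - C * B * y ^ (k + q + 1) =
      ∫ τ in (0 : ℝ)..y, (Φ τ - C * τ ^ k) * (y - τ) ^ q := by
    rw [h.depthIntegral_eq_intervalIntegral hq hy.le, mul_assoc, mul_comm B,
      ← integral_rpow_mul_sub_rpow hy, ← intervalIntegral.integral_const_mul,
      ← intervalIntegral.integral_sub hI (hI'.const_mul C)]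
    refine intervalIntegral.integral_congr fun τ _ => ?_
    ring
  have hle : |depthIntegral Φ q y - C * B * y ^ (k + q + 1)| ≤ ε' * (y ^ (k + q + 1) * B) := by
    rw [hdiff, ← integral_rpow_mul_sub_rpow hy, ← intervalIntegral.integral_const_mul]
    rw [← Real.norm_eq_abs]
    refine intervalIntegral.norm_integral_le_of_norm_le hy.le ?_ (hI'.const_mul ε')
    refine Eventually.of_forall fun τ hτ => ?_
    have h1 : |Φ τ - C * τ ^ k| ≤ ε' * τ ^ k := hbd ⟨hτ.1, hτ.2.trans hyt.2⟩
    have h2 : 0 ≤ (y - τ) ^ q := Real.rpow_nonneg (by linarith [hτ.2]) _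
    rw [Real.norm_eq_abs, abs_mul, abs_of_nonneg h2, ← mul_assoc]
    exact mul_le_mul_of_nonneg_right h1 h2
  rw [Real.dist_eq]
  have h3 : depthIntegral Φ q y / y ^ (k + q + 1) - C * B =
      (depthIntegral Φ q y - C * B * y ^ (k + q + 1)) / y ^ (k + q + 1) := by
    field_simp
  rw [h3, abs_div, abs_of_pos hyn, div_lt_iff₀ hyn]
  refine lt_of_le_of_lt hle ?_
  have h4 : ε' * (y ^ (k + q + 1) * B) = ε / 2 * y ^ (k + q + 1) := by
    rw [hε']; field_simp
  rw [h4]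
  exact mul_lt_mul_of_pos_right (by linarith) hyn

theorem depthIntegral_pos (h : RegularProfile S k C Φ) (hC : 0 < C) (hk : -1 < k) (hq : 0 < q)
    {y : ℝ} (hy : 0 < y) (hyS : y ∈ S) : 0 < depthIntegral Φ q y := by
  have hlim := h.tendsto_depthIntegral hk hq
  have hpos := mul_pos hC (integral_rpow_mul_one_sub_rpow_pos hk hq)
  obtain ⟨z, hz, hz0, hzy⟩ := ((hlim.eventually (lt_mem_nhds hpos)).and
    (Ioc_mem_nhdsGT hy)).exists
  refine lt_of_lt_of_le ?_ (h.depthIntegral_mono hq hyS hzy)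
  exact (div_pos_iff_of_pos_right (Real.rpow_pos_of_pos hz0 _)).1 hz

end RegularProfile

/-! ### Angular momentum and polar coordinates in velocity space -/

theorem angularMomentumSq_eq (x v : R3) :
    angularMomentumSq x v = ‖x‖ ^ 2 * ‖v‖ ^ 2 - (inner ℝ x v) ^ 2 := by
  have h1 : ∀ u w : R3, u.ofLp ⬝ᵥ w.ofLp = inner ℝ u w := fun u w => by
    rw [EuclideanSpace.inner_eq_star_dotProduct, star_trivial, dotProduct_comm]
  rw [angularMomentumSq, cross_dot_cross, h1, h1, h1, h1, real_inner_self_eq_norm_sq,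
    real_inner_self_eq_norm_sq, real_inner_comm v x]
  ring

theorem angularMomentumSq_nonneg (x v : R3) : 0 ≤ angularMomentumSq x v := by
  rw [angularMomentumSq_eq]
  have := abs_real_inner_le_norm x v
  nlinarith [sq_abs (inner ℝ x v), abs_nonneg (inner ℝ x v)]

theorem continuous_angularMomentumSq (x : R3) : Continuous (angularMomentumSq x) := by
  have : angularMomentumSq x = fun v => ‖x‖ ^ 2 * ‖v‖ ^ 2 - (inner ℝ x v) ^ 2 :=
    funext (angularMomentumSq_eq x)
  rw [this]
  fun_prop

theorem angularMomentumSq_smul_right (x v : R3) (s : ℝ) :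
    angularMomentumSq x (s • v) = s ^ 2 * angularMomentumSq x v := by
  rw [angularMomentumSq_eq, angularMomentumSq_eq, inner_smul_right, norm_smul, mul_pow,
    Real.norm_eq_abs, sq_abs]
  ring

theorem angularMomentumSq_smul_left (x v : R3) (s : ℝ) :
    angularMomentumSq (s • x) v = s ^ 2 * angularMomentumSq x v := by
  rw [angularMomentumSq_eq, angularMomentumSq_eq, real_inner_smul_left, norm_smul, mul_pow,
    Real.norm_eq_abs, sq_abs]
  ring

theorem angularMomentumSq_map (e : R3 ≃ₗᵢ[ℝ] R3) (x v : R3) :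
    angularMomentumSq (e x) (e v) = angularMomentumSq x v := by
  simp [angularMomentumSq_eq]

/-- Polar coordinates for the product of a radial function and a function that is homogeneous of
degree `d`. -/
theorem lintegral_radial_mul_homogeneous {E : Type*} [NormedAddCommGroup E] [NormedSpace ℝ E]
    [MeasurableSpace E] [BorelSpace E] [FiniteDimensional ℝ E] [Nontrivial E]
    (μ : Measure E) [μ.IsAddHaarMeasure] {d : ℝ}
    {ψ : ℝ → ENNReal} {h : E → ENNReal} (hψ : Measurable ψ) (hh : Measurable h)
    (hom : ∀ s : ℝ, 0 < s → ∀ v, h (s • v) = ENNReal.ofReal (s ^ d) * h v) :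
    ∫⁻ v, ψ ‖v‖ * h v ∂μ = (∫⁻ ω : Metric.sphere (0 : E) 1, h ω ∂μ.toSphere) *
      ∫⁻ s in Set.Ioi (0 : ℝ), ENNReal.ofReal (s ^ (d + (Module.finrank ℝ E - 1 : ℕ))) * ψ s := by
  have hme : Measurable fun s : ℝ => ENNReal.ofReal (s ^ d) * ψ s :=
    (measurable_id.pow_const d).ennreal_ofReal.mul hψ
  calc ∫⁻ v, ψ ‖v‖ * h v ∂μ
      = ∫⁻ v : ({(0)}ᶜ : Set E), ψ ‖v.1‖ * h v.1 ∂(μ.comap (↑)) := by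
        rw [lintegral_subtype_comap (measurableSet_singleton _).compl fun v => ψ ‖v‖ * h v,
          restrict_compl_singleton]
    _ = ∫⁻ z, h z.1 * (ENNReal.ofReal (z.2.1 ^ d) * ψ z.2.1)
          ∂μ.toSphere.prod (.volumeIoiPow (Module.finrank ℝ E - 1)) := by
        rw [← (μ.measurePreserving_homeomorphUnitSphereProd).lintegral_comp_emb
          (Homeomorph.measurableEmbedding _)]
        refine lintegral_congr fun v => ?_
        have hv : 0 < ‖v.1‖ := norm_pos_iff.2 v.2
        have h1 : h v.1 = ENNReal.ofReal (‖v.1‖ ^ d) * h (‖v.1‖⁻¹ • v.1) := by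
          rw [← hom _ hv, smul_smul, mul_inv_cancel₀ hv.ne', one_smul]
        rw [h1]
        simp only [homeomorphUnitSphereProd_apply_fst_coe, homeomorphUnitSphereProd_apply_snd_coe]
        ring
    _ = (∫⁻ ω : Metric.sphere (0 : E) 1, h ω ∂μ.toSphere) *
          ∫⁻ s : Set.Ioi (0 : ℝ), ENNReal.ofReal (s.1 ^ d) * ψ s.1
            ∂(.volumeIoiPow (Module.finrank ℝ E - 1)) := by
        exact lintegral_prod_mul (f := fun ω : Metric.sphere (0 : E) 1 => h ω)
          (g := fun s : Set.Ioi (0 : ℝ) => ENNReal.ofReal (s.1 ^ d) * ψ s.1)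
          (hh.comp measurable_subtype_coe).aemeasurable
          (hme.comp measurable_subtype_coe).aemeasurable
    _ = _ := by
        congr 1
        rw [Measure.volumeIoiPow, lintegral_withDensity_eq_lintegral_mul _
          (by fun_prop) (g := fun s : Set.Ioi (0 : ℝ) => ENNReal.ofReal (s.1 ^ d) * ψ s.1)
          (hme.comp measurable_subtype_coe)]
        simp only [Pi.mul_apply]
        rw [lintegral_subtype_comap measurableSet_Ioi fun s : ℝ =>
          ENNReal.ofReal (s ^ (Module.finrank ℝ E - 1)) * (ENNReal.ofReal (s ^ d) * ψ s)]
        refine setLIntegral_congr_fun measurableSet_Ioi fun s hs => ?_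
        have hs0 : (0 : ℝ) < s := hs
        rw [← mul_assoc, ← ENNReal.ofReal_mul (by positivity), Real.rpow_add hs0,
          Real.rpow_natCast, mul_comm (s ^ d)]

/-- The integral of `L(e, ω) ^ l` over `ω` in the unit sphere, for a fixed unit vector `e`. -/
noncomputable def angularConstant (l : ℝ) : ENNReal :=
  ∫⁻ ω : Metric.sphere (0 : R3) 1,
    ENNReal.ofReal (angularMomentumSq (EuclideanSpace.single 0 1) ω ^ l) ∂volume.toSphere

theorem measurable_angularMomentumSq_rpow (x : R3) (l : ℝ) :
    Measurable fun v => angularMomentumSq x v ^ l :=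
  (continuous_angularMomentumSq x).measurable.pow_const l

theorem lintegral_axis_radial_mul_angularMomentumSq (l : ℝ) {ψ : ℝ → ENNReal} (hψ : Measurable ψ) :
    ∫⁻ v : R3, ψ ‖v‖ *
        ENNReal.ofReal (angularMomentumSq (EuclideanSpace.single 0 1) v ^ l) =
      angularConstant l * ∫⁻ s in Set.Ioi (0 : ℝ), ENNReal.ofReal (s ^ (2 * l + 2)) * ψ s := by
  have := lintegral_radial_mul_homogeneous (volume : Measure R3) (d := 2 * l) hψ
    (h := fun v => ENNReal.ofReal (angularMomentumSq (EuclideanSpace.single 0 1) v ^ l))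
    (measurable_angularMomentumSq_rpow _ l).ennreal_ofReal ?_
  · rw [this, angularConstant]
    simp
  · intro s hs v
    rw [angularMomentumSq_smul_right, Real.mul_rpow (by positivity) (angularMomentumSq_nonneg _ _),
      ENNReal.ofReal_mul (by positivity), Real.rpow_mul hs.le, Real.rpow_two]

/-- A reflection takes the first axis to the direction of `x`. -/
theorem lintegral_radial_mul_angularMomentumSq (l : ℝ) {ψ : ℝ → ENNReal} (hψ : Measurable ψ)
    {x : R3} (hx : x ≠ 0) :
    ∫⁻ v : R3, ψ ‖v‖ * ENNReal.ofReal (angularMomentumSq x v ^ l) =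
      angularConstant l * ENNReal.ofReal (‖x‖ ^ (2 * l)) *
        ∫⁻ s in Set.Ioi (0 : ℝ), ENNReal.ofReal (s ^ (2 * l + 2)) * ψ s := by
  have hx0 : 0 < ‖x‖ := norm_pos_iff.2 hx
  set e₀ : R3 := EuclideanSpace.single 0 1 with he₀
  have hnorm : ‖‖x‖ • e₀‖ = ‖x‖ := by simp [norm_smul, he₀]
  set e : R3 ≃ₗᵢ[ℝ] R3 := Submodule.reflection (Submodule.span ℝ {‖x‖ • e₀ - x})ᗮ with he
  have hex : e (‖x‖ • e₀) = x := Submodule.reflection_sub hnorm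
  rw [← e.measurePreserving.lintegral_comp_emb e.toHomeomorph.measurableEmbedding]
  have hL : ∀ v, angularMomentumSq x (e v) = ‖x‖ ^ 2 * angularMomentumSq e₀ v := fun v => by
    rw [← angularMomentumSq_smul_left, ← angularMomentumSq_map e (‖x‖ • e₀) v, hex]
  have : ∀ v, ψ ‖e v‖ * ENNReal.ofReal (angularMomentumSq x (e v) ^ l) =
      ENNReal.ofReal (‖x‖ ^ (2 * l)) * (ψ ‖v‖ * ENNReal.ofReal (angularMomentumSq e₀ v ^ l)) := by
    intro v
    rw [hL, e.norm_map, Real.mul_rpow (by positivity) (angularMomentumSq_nonneg _ _),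
      ENNReal.ofReal_mul (by positivity), Real.rpow_mul hx0.le, Real.rpow_two]
    ring
  simp_rw [this]
  rw [lintegral_const_mul' _ _ ENNReal.ofReal_ne_top,
    lintegral_axis_radial_mul_angularMomentumSq l hψ]
  ring

theorem angularMomentumSq_axis (v : R3) :
    angularMomentumSq (EuclideanSpace.single 0 1) v = v 1 ^ 2 + v 2 ^ 2 := by
  simp [angularMomentumSq, cross_apply]
  ring

theorem angularConstant_pos (l : ℝ) : 0 < angularConstant l := by
  rw [angularConstant, lintegral_pos_iff_support (f := fun ω : Metric.sphere (0 : R3) 1 =>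
    ENNReal.ofReal (angularMomentumSq (EuclideanSpace.single 0 1) ω ^ l))
    ((measurable_angularMomentumSq_rpow _ l).ennreal_ofReal.comp measurable_subtype_coe)]
  set U : Set (Metric.sphere (0 : R3) 1) :=
    {ω | 0 < angularMomentumSq (EuclideanSpace.single 0 1) ω} with hU
  have hUo : IsOpen U := isOpen_lt continuous_const
    ((continuous_angularMomentumSq _).comp continuous_subtype_val)
  have hUn : U.Nonempty :=
    ⟨⟨EuclideanSpace.single 1 1, by simp⟩, by simp [hU, angularMomentumSq_axis]⟩
  refine (hUo.measure_pos _ hUn).trans_le (measure_mono fun ω hω => ?_)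
  simp only [Function.mem_support, ne_eq, ENNReal.ofReal_eq_zero, not_le]
  exact Real.rpow_pos_of_pos hω l

/-- For `l < 0` the integrand is singular on a line; as `2 l > -1` it is dominated by the singular
factor `|v₁| ^ (2 l)` of a single coordinate, which is integrable on its own. -/
theorem lintegral_ball_angularMomentumSq_rpow_lt_top {l : ℝ} (hl : -1 / 2 < l) :
    ∫⁻ v in Metric.ball (0 : R3) 1,
      ENNReal.ofReal (angularMomentumSq (EuclideanSpace.single 0 1) v ^ l) < ⊤ := by
  -- Away from `v₁ = 0` one has `(v₁² + v₂²) ^ l ≤ 1 + |v₁| ^ (2 l)` on the ball.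
  set g : Fin 3 → ℝ → ℝ := fun i t =>
    (Set.Icc (-1 : ℝ) 1).indicator (fun t => if i = 1 then 1 + |t| ^ (2 * l) else 1) t with hg
  have hgi : ∀ i, Integrable (g i) := by
    intro i
    refine (integrable_indicator_iff measurableSet_Icc).2 ?_
    by_cases hi : i = 1
    · simp only [hi, if_true]
      refine Integrable.add (integrableOn_const (by simp)) ?_
      have h0 : IntegrableOn (fun t : ℝ => |t| ^ (2 * l)) (Set.Ioc 0 1) := by
        have := intervalIntegral.intervalIntegrable_rpow' (by linarith : -1 < 2 * l)
          (a := 0) (b := 1)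
        rw [intervalIntegrable_iff_integrableOn_Ioc_of_le zero_le_one] at this
        exact this.congr_fun (fun t ht => by simp only [abs_of_pos ht.1]) measurableSet_Ioc
      have h1 : IntegrableOn (fun t : ℝ => |t| ^ (2 * l)) (Set.Icc 0 1) :=
        (integrableOn_Icc_iff_integrableOn_Ioc (by simp)).2 h0
      have h2 : IntegrableOn (fun t : ℝ => |t| ^ (2 * l)) (Set.Icc (-1) 0) := by
        have := ((integrable_indicator_iff measurableSet_Icc).2 h1).comp_neg
        refine (integrable_indicator_iff measurableSet_Icc).1 (this.congr ?_)
        refine Eventually.of_forall fun t => ?_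
        simp only [Set.indicator, Set.mem_Icc, abs_neg, neg_nonneg, neg_le, and_comm]
      rw [← Set.Icc_union_Icc_eq_Icc (by norm_num : (-1 : ℝ) ≤ 0) zero_le_one]
      exact h2.union h1
    · simp only [hi, if_false]
      exact integrableOn_const (by simp)
  have hint : Integrable fun w : Fin 3 → ℝ => ∏ i, g i (w i) :=
    Integrable.fintype_prod hgi
  have hint' : Integrable fun v : R3 => ∏ i, g i (v i) :=
    (PiLp.volume_preserving_ofLp (Fin 3)).integrable_comp_of_integrable hint
  refine lt_of_le_of_lt ?_ hint'.lintegral_lt_top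
  have hne : ∀ᵐ v : R3, v 1 ≠ 0 := by
    have h1 : ∀ᵐ w : Fin 3 → ℝ, w 1 ≠ 0 :=
      (Measure.quasiMeasurePreserving_eval (fun _ => volume) (1 : Fin 3)).ae
        (Measure.ae_ne volume 0)
    exact (PiLp.volume_preserving_ofLp (Fin 3)).quasiMeasurePreserving.ae h1
  rw [← lintegral_indicator measurableSet_ball]
  refine lintegral_mono_ae ?_
  filter_upwards [hne] with v hv
  by_cases hvb : v ∈ Metric.ball (0 : R3) 1
  · rw [Set.indicator_of_mem hvb]
    refine ENNReal.ofReal_le_ofReal ?_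
    have hv1 : ‖v‖ < 1 := by simpa using hvb
    have hvi : ∀ i, v i ∈ Set.Icc (-1 : ℝ) 1 := fun i =>
      abs_le.1 ((PiLp.norm_apply_le v i).trans hv1.le)
    have hsq : v 1 ^ 2 + v 2 ^ 2 ≤ 1 := by
      rw [← angularMomentumSq_axis, angularMomentumSq_eq]
      have : ‖v‖ ^ 2 ≤ 1 := by nlinarith [norm_nonneg v]
      simp only [PiLp.norm_single, norm_one, one_pow, one_mul]
      nlinarith [sq_nonneg (inner ℝ (EuclideanSpace.single 0 1) v)]
    have hprod : ∏ i, g i (v i) = 1 + |v 1| ^ (2 * l) := by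
      simp [hg, Set.indicator_of_mem (hvi _)]
    rw [hprod, angularMomentumSq_axis]
    have hv1sq : 0 < v 1 ^ 2 := by positivity
    have hnn : 0 ≤ |v 1| ^ (2 * l) := Real.rpow_nonneg (abs_nonneg _) _
    rcases le_or_gt 0 l with h0 | h0
    · have := Real.rpow_le_one (by positivity : 0 ≤ v 1 ^ 2 + v 2 ^ 2) hsq h0
      linarith
    · have h1 : (v 1 ^ 2 + v 2 ^ 2) ^ l ≤ (v 1 ^ 2) ^ l :=
        Real.rpow_le_rpow_of_nonpos hv1sq (by nlinarith [sq_nonneg (v 2)]) h0.le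
      have h2 : (v 1 ^ 2) ^ l = |v 1| ^ (2 * l) := by
        rw [Real.rpow_mul (abs_nonneg _), Real.rpow_two, sq_abs]
      linarith
  · rw [Set.indicator_of_notMem hvb]
    exact zero_le

/-- Finiteness on the ball transfers to the sphere through polar coordinates. -/
theorem angularConstant_lt_top {l : ℝ} (hl : -1 / 2 < l) : angularConstant l < ⊤ := by
  have h := lintegral_axis_radial_mul_angularMomentumSq l
    (ψ := (Set.Iio (1 : ℝ)).indicator 1) (measurable_one.indicator measurableSet_Iio)
  have hlhs : ∫⁻ v : R3, (Set.Iio (1 : ℝ)).indicator 1 ‖v‖ *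
        ENNReal.ofReal (angularMomentumSq (EuclideanSpace.single 0 1) v ^ l) < ⊤ := by
    refine lt_of_eq_of_lt ?_ (lintegral_ball_angularMomentumSq_rpow_lt_top hl)
    rw [← lintegral_indicator measurableSet_ball]
    refine lintegral_congr fun v => ?_
    by_cases hv : ‖v‖ < 1 <;> simp [Set.indicator, hv]
  rw [h] at hlhs
  refine lt_top_iff_ne_top.2 fun htop => ?_
  rw [htop, ENNReal.top_mul] at hlhs
  · exact lt_irrefl _ hlhs
  · refine (lintegral_pos_iff_support ?_).2 ?_ |>.ne'
    · exact (measurable_id.pow_const _).ennreal_ofReal.mul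
        (measurable_one.indicator measurableSet_Iio)
    · rw [Measure.restrict_apply' measurableSet_Ioi]
      have : (0 : ENNReal) < volume (Set.Ioo (0 : ℝ) 1) := by simp
      refine this.trans_le (measure_mono fun s hs => ⟨?_, hs.1⟩)
      have := Real.rpow_pos_of_pos hs.1 (2 * l + 2)
      simp [hs.2, this]

/-! ### Velocity integrals of the distribution function -/

theorem setLIntegral_Iio_integrand {l : ℝ} {Φ : ℝ → ℝ} (hl : -1 / 2 < l) (y : ℝ) :
    ∫⁻ τ in Set.Iio y, ENNReal.ofReal (Φ τ * max (y - τ) 0 ^ (l + 1 / 2)) =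
      ∫⁻ τ, ENNReal.ofReal (Φ τ * max (y - τ) 0 ^ (l + 1 / 2)) := by
  refine setLIntegral_eq_of_support_subset fun τ hτ => ?_
  by_contra h
  rw [Set.mem_Iio, not_lt] at h
  refine hτ ?_
  simp only
  rw [max_eq_right (by linarith), Real.zero_rpow (by linarith), mul_zero, ENNReal.ofReal_zero]

/-- The substitution `τ = y - s ^ 2 / 2`, from speed to the distance from the cut-off energy. -/
theorem lintegral_newtonian_radial {l : ℝ} {Φ : ℝ → ℝ} (hl : -1 / 2 < l) (y : ℝ) :
    ∫⁻ s in Set.Ioi (0 : ℝ), ENNReal.ofReal (s ^ (2 * l + 2)) * ENNReal.ofReal (Φ (y - s ^ 2 / 2)) =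
      ENNReal.ofReal (2 ^ (l + 1 / 2)) *
        ∫⁻ τ, ENNReal.ofReal (Φ τ * max (y - τ) 0 ^ (l + 1 / 2)) := by
  have himg : (fun s : ℝ => y - s ^ 2 / 2) '' Set.Ioi 0 = Set.Iio y := by
    ext τ
    simp only [Set.mem_image, Set.mem_Ioi, Set.mem_Iio]
    constructor
    · rintro ⟨s, hs, rfl⟩
      have : 0 < s ^ 2 := by positivity
      linarith
    · intro hτ
      refine ⟨Real.sqrt (2 * (y - τ)), Real.sqrt_pos.2 (by linarith), ?_⟩
      rw [Real.sq_sqrt (by linarith)]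
      ring
  have hinj : Set.InjOn (fun s : ℝ => y - s ^ 2 / 2) (Set.Ioi 0) := by
    intro s hs t ht hst
    have hs0 : (0 : ℝ) < s := hs
    have ht0 : (0 : ℝ) < t := ht
    have : s ^ 2 = t ^ 2 := by simp only at hst; linarith
    exact (pow_left_inj₀ hs0.le ht0.le two_ne_zero).1 this
  have hder : ∀ s ∈ Set.Ioi (0 : ℝ),
      HasDerivWithinAt (fun s : ℝ => y - s ^ 2 / 2) (-s) (Set.Ioi 0) s := fun s _ => by
    have := (((hasDerivAt_pow 2 s).div_const 2).const_sub y).hasDerivWithinAt (s := Set.Ioi 0)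
    refine this.congr_deriv ?_
    simp
  rw [← setLIntegral_Iio_integrand hl y, ← himg,
    lintegral_image_eq_lintegral_abs_deriv_mul measurableSet_Ioi hder hinj,
    ← lintegral_const_mul' _ _ ENNReal.ofReal_ne_top]
  refine setLIntegral_congr_fun measurableSet_Ioi fun s hs => ?_
  have hs0 : (0 : ℝ) < s := hs
  rw [← ENNReal.ofReal_mul (by positivity), ← ENNReal.ofReal_mul (by positivity),
    ← ENNReal.ofReal_mul (by positivity)]
  congr 1
  have h1 : max (y - (y - s ^ 2 / 2)) 0 = s ^ 2 / 2 := by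
    rw [sub_sub_cancel]; exact max_eq_left (by positivity)
  have h2 : s ^ (2 * l + 2) = s * (s ^ 2) ^ (l + 1 / 2) := by
    rw [← Real.rpow_natCast s 2, ← Real.rpow_mul hs0.le]
    nth_rewrite 2 [← Real.rpow_one s]
    rw [← Real.rpow_add hs0]
    congr 1
    push_cast
    ring
  rw [h1, abs_neg, abs_of_pos hs0, Real.div_rpow (by positivity) two_pos.le, h2]
  have := Real.rpow_pos_of_pos two_pos (l + 1 / 2)
  field_simp

/-- The constant in front of `|x| ^ (2 l)` times `depthIntegral` in the formula for the density. -/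
noncomputable def densityConstant (l : ℝ) : ℝ := (angularConstant l).toReal * 2 ^ (l + 1 / 2)

theorem densityConstant_pos {l : ℝ} (hl : -1 / 2 < l) : 0 < densityConstant l :=
  mul_pos (ENNReal.toReal_pos (angularConstant_pos l).ne' (angularConstant_lt_top hl).ne)
    (Real.rpow_pos_of_pos two_pos _)

/-- The substitution `τ = 1 - β √(1 + s ^ 2)`, from speed to the distance from the cut-off energy;
`β` is the quotient of the energy at rest and the cut-off energy. -/
theorem lintegral_relativistic_substitution {l : ℝ} {Φ : ℝ → ℝ} (hl : -1 / 2 < l) {β : ℝ}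
    (hβ : 0 < β) :
    ∫⁻ τ, ENNReal.ofReal (Φ τ * max (1 - β - τ) 0 ^ (l + 1 / 2)) =
      ∫⁻ s in Set.Ioi (0 : ℝ), ENNReal.ofReal (β * s / Real.sqrt (1 + s ^ 2)) *
        ENNReal.ofReal (Φ (1 - β * Real.sqrt (1 + s ^ 2)) *
          (β * (Real.sqrt (1 + s ^ 2) - 1)) ^ (l + 1 / 2)) := by
  have hone : ∀ s : ℝ, 1 ≤ Real.sqrt (1 + s ^ 2) := fun s =>
    Real.one_le_sqrt.2 (by nlinarith [sq_nonneg s])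
  have himg : (fun s : ℝ => 1 - β * Real.sqrt (1 + s ^ 2)) '' Set.Ioi 0 = Set.Iio (1 - β) := by
    ext τ
    simp only [Set.mem_image, Set.mem_Ioi, Set.mem_Iio]
    constructor
    · rintro ⟨s, hs, rfl⟩
      have : 1 < Real.sqrt (1 + s ^ 2) := by
        rw [Real.lt_sqrt zero_le_one]
        have : 0 < s ^ 2 := by positivity
        linarith
      nlinarith
    · intro hτ
      have hw : 1 < (1 - τ) / β := by rw [lt_div_iff₀ hβ]; linarith
      refine ⟨Real.sqrt (((1 - τ) / β) ^ 2 - 1), Real.sqrt_pos.2 (by nlinarith), ?_⟩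
      rw [Real.sq_sqrt (by nlinarith), add_sub_cancel, Real.sqrt_sq (by linarith)]
      field_simp
      ring
  have hinj : Set.InjOn (fun s : ℝ => 1 - β * Real.sqrt (1 + s ^ 2)) (Set.Ioi 0) := by
    intro s hs t ht hst
    have hs0 : (0 : ℝ) < s := hs
    have ht0 : (0 : ℝ) < t := ht
    have h1 : Real.sqrt (1 + s ^ 2) = Real.sqrt (1 + t ^ 2) := by
      simp only at hst
      exact mul_left_cancel₀ hβ.ne' (by linarith)
    rw [Real.sqrt_inj (by positivity) (by positivity)] at h1
    exact (pow_left_inj₀ hs0.le ht0.le two_ne_zero).1 (by linarith)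
  have hder : ∀ s ∈ Set.Ioi (0 : ℝ), HasDerivWithinAt (fun s : ℝ => 1 - β * Real.sqrt (1 + s ^ 2))
      (-(β * s / Real.sqrt (1 + s ^ 2))) (Set.Ioi 0) s := fun s _ => by
    have h0 : (1 + s ^ 2 : ℝ) ≠ 0 := by positivity
    have := (((((hasDerivAt_pow 2 s).const_add 1).sqrt h0).const_mul β).const_sub
      1).hasDerivWithinAt (s := Set.Ioi 0)
    refine this.congr_deriv ?_
    have := hone s
    field_simp
    simp
  rw [← setLIntegral_Iio_integrand hl (1 - β), ← himg,
    lintegral_image_eq_lintegral_abs_deriv_mul measurableSet_Ioi hder hinj]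
  refine setLIntegral_congr_fun measurableSet_Ioi fun s hs => ?_
  have hs0 : (0 : ℝ) < s := hs
  have h1 := hone s
  rw [abs_neg, abs_of_nonneg (by positivity), max_eq_left (by nlinarith)]
  congr 4
  ring

namespace RegularProfile

variable {S : Set ℝ} {k C l : ℝ} {Φ : ℝ → ℝ}

theorem lintegral_newtonian_density (h : RegularProfile S k C Φ) (hl : -1 / 2 < l) {y : ℝ}
    (hy : y ∈ S) {x : R3} (hx : x ≠ 0) :
    ∫⁻ v : R3, ENNReal.ofReal (Φ (y - ‖v‖ ^ 2 / 2) * angularMomentumSq x v ^ l) =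
      ENNReal.ofReal (densityConstant l * ‖x‖ ^ (2 * l) * depthIntegral Φ (l + 1 / 2) y) := by
  have hψ : Measurable fun s : ℝ => ENNReal.ofReal (Φ (y - s ^ 2 / 2)) :=
    (h.measurable.comp (by fun_prop)).ennreal_ofReal
  simp_rw [ENNReal.ofReal_mul (h.nonneg _)]
  rw [lintegral_radial_mul_angularMomentumSq l hψ hx, lintegral_newtonian_radial hl,
    h.lintegral_eq_ofReal_depthIntegral (by linarith) hy, densityConstant,
    ENNReal.ofReal_mul (by positivity), ENNReal.ofReal_mul (by positivity),
    ENNReal.ofReal_mul (by positivity), ENNReal.ofReal_toReal (angularConstant_lt_top hl).ne]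
  ring

/-- The relativistic density integrand differs from the one of `depthIntegral` by a factor that
tends to `2 ^ (l + 1 / 2)` as `β → 1`. -/
theorem relativistic_integrand_bounds (h : RegularProfile S k C Φ) (hl : -1 / 2 < l) {β s : ℝ}
    (hβ : 0 < β) (hs : 0 < s) :
    2 ^ (l + 1 / 2) * (β * s / Real.sqrt (1 + s ^ 2) * (Φ (1 - β * Real.sqrt (1 + s ^ 2)) *
        (β * (Real.sqrt (1 + s ^ 2) - 1)) ^ (l + 1 / 2))) ≤
      s ^ (2 * l + 2) * (Real.sqrt (1 + s ^ 2) * Φ (1 - β * Real.sqrt (1 + s ^ 2))) ∧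
    s ^ (2 * l + 2) * (Real.sqrt (1 + s ^ 2) * Φ (1 - β * Real.sqrt (1 + s ^ 2))) ≤
      2 ^ (l + 1 / 2) * β⁻¹ ^ (2 * l + 4) * (β * s / Real.sqrt (1 + s ^ 2) *
        (Φ (1 - β * Real.sqrt (1 + s ^ 2)) *
          (β * (Real.sqrt (1 + s ^ 2) - 1)) ^ (l + 1 / 2))) := by
  set R := Real.sqrt (1 + s ^ 2) with hR
  have hRsq : R ^ 2 = 1 + s ^ 2 := Real.sq_sqrt (by positivity)
  have hR1 : 1 < R := by
    rw [hR, Real.lt_sqrt zero_le_one]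
    have : 0 < s ^ 2 := by positivity
    linarith
  rcases le_or_gt (1 - β * R) 0 with h0 | h0
  · -- Beyond the cut-off energy both sides vanish.
    rw [h.eq_zero _ h0]
    simp
  have hq : 0 < l + 1 / 2 := by linarith
  set q := l + 1 / 2 with hq_def
  have hβ1 : β < 1 := by nlinarith
  have hRβ : R ≤ β⁻¹ := by
    rw [← one_div, le_div_iff₀ hβ]; linarith
  have hβi : 1 ≤ β⁻¹ := hR1.le.trans hRβ
  have hs2 : s ^ (2 * l + 2) = s * ((R - 1) ^ q * (R + 1) ^ q) := by
    rw [← Real.mul_rpow (by linarith) (by linarith)]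
    have : (R - 1) * (R + 1) = s ^ 2 := by linear_combination hRsq
    rw [this, ← Real.rpow_natCast s 2, ← Real.rpow_mul hs.le]
    nth_rewrite 2 [← Real.rpow_one s]
    rw [← Real.rpow_add hs]
    congr 1
    rw [hq_def]
    push_cast
    ring
  -- The quotient of the two integrands is `W`.
  set W := R ^ 2 * (R + 1) ^ q * β⁻¹ ^ (1 + q) with hW
  have hfac : s ^ (2 * l + 2) * (R * Φ (1 - β * R)) =
      W * (β * s / R * (Φ (1 - β * R) * (β * (R - 1)) ^ q)) := by
    rw [hs2, hW, Real.mul_rpow hβ.le (by linarith), Real.inv_rpow hβ.le, Real.rpow_add hβ,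
      Real.rpow_one]
    have := Real.rpow_pos_of_pos hβ q
    field_simp
  have hnn : 0 ≤ β * s / R * (Φ (1 - β * R) * (β * (R - 1)) ^ q) :=
    mul_nonneg (by positivity) (mul_nonneg (h.nonneg _)
      (Real.rpow_nonneg (mul_nonneg hβ.le (by linarith)) _))
  rw [hfac]
  refine ⟨mul_le_mul_of_nonneg_right ?_ hnn, mul_le_mul_of_nonneg_right ?_ hnn⟩
  · have h1 : (2 : ℝ) ^ q ≤ (R + 1) ^ q := Real.rpow_le_rpow two_pos.le (by linarith) hq.le
    have h2 : 1 ≤ β⁻¹ ^ (1 + q) := Real.one_le_rpow hβi (by linarith)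
    have h3 : 1 ≤ R ^ 2 := by nlinarith
    have h4 : 0 < (R + 1) ^ q := Real.rpow_pos_of_pos (by linarith) _
    calc (2 : ℝ) ^ q ≤ 1 * (R + 1) ^ q * 1 := by linarith
      _ ≤ W := by rw [hW]; gcongr
  · have h1 : (R + 1) ^ q ≤ (2 * β⁻¹) ^ q :=
      Real.rpow_le_rpow (by linarith) (by linarith) hq.le
    rw [Real.mul_rpow two_pos.le (by positivity)] at h1
    have h3 : R ^ 2 ≤ β⁻¹ ^ 2 := by gcongr
    calc W ≤ β⁻¹ ^ 2 * (2 ^ q * β⁻¹ ^ q) * β⁻¹ ^ (1 + q) := by rw [hW]; gcongr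
      _ = 2 ^ q * (β⁻¹ ^ (2 : ℝ) * β⁻¹ ^ q * β⁻¹ ^ (1 + q)) := by rw [Real.rpow_two]; ring
      _ = 2 ^ q * β⁻¹ ^ (2 * l + 4) := by
        rw [← Real.rpow_add (by positivity), ← Real.rpow_add (by positivity)]
        congr 2
        rw [hq_def]
        ring
      _ ≤ _ := le_rfl

theorem lintegral_relativistic_density_bounds (h : RegularProfile S k C Φ) (hl : -1 / 2 < l)
    {β : ℝ} (hβ : 0 < β) (hy : 1 - β ∈ S) {x : R3} (hx : x ≠ 0) :
    ENNReal.ofReal (densityConstant l * ‖x‖ ^ (2 * l) * depthIntegral Φ (l + 1 / 2) (1 - β)) ≤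
      ∫⁻ v : R3, ENNReal.ofReal (Real.sqrt (1 + ‖v‖ ^ 2) *
        (Φ (1 - β * Real.sqrt (1 + ‖v‖ ^ 2)) * angularMomentumSq x v ^ l)) ∧
    ∫⁻ v : R3, ENNReal.ofReal (Real.sqrt (1 + ‖v‖ ^ 2) *
        (Φ (1 - β * Real.sqrt (1 + ‖v‖ ^ 2)) * angularMomentumSq x v ^ l)) ≤
      ENNReal.ofReal (β⁻¹ ^ (2 * l + 4) *
        (densityConstant l * ‖x‖ ^ (2 * l) * depthIntegral Φ (l + 1 / 2) (1 - β))) := by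
  have hψ : Measurable fun s : ℝ => ENNReal.ofReal (Real.sqrt (1 + s ^ 2) *
      Φ (1 - β * Real.sqrt (1 + s ^ 2))) := by
    refine Measurable.ennreal_ofReal (Measurable.mul (by fun_prop) (h.measurable.comp ?_))
    fun_prop
  have hA := (densityConstant_pos hl).le
  have hJ := h.depthIntegral_nonneg (l + 1 / 2) (1 - β)
  have hconst : ENNReal.ofReal (densityConstant l * ‖x‖ ^ (2 * l) *
      depthIntegral Φ (l + 1 / 2) (1 - β)) = angularConstant l * ENNReal.ofReal (‖x‖ ^ (2 * l)) *
        (ENNReal.ofReal (2 ^ (l + 1 / 2)) * ∫⁻ s in Set.Ioi (0 : ℝ),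
          ENNReal.ofReal (β * s / Real.sqrt (1 + s ^ 2)) *
        ENNReal.ofReal (Φ (1 - β * Real.sqrt (1 + s ^ 2)) *
          (β * (Real.sqrt (1 + s ^ 2) - 1)) ^ (l + 1 / 2))) := by
    rw [← lintegral_relativistic_substitution hl hβ,
      h.lintegral_eq_ofReal_depthIntegral (by linarith) hy,
      densityConstant, ENNReal.ofReal_mul (by positivity), ENNReal.ofReal_mul (by positivity),
      ENNReal.ofReal_mul (by positivity), ENNReal.ofReal_toReal (angularConstant_lt_top hl).ne]
    ring
  have hsplit : ∀ v : R3, ENNReal.ofReal (Real.sqrt (1 + ‖v‖ ^ 2) *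
        (Φ (1 - β * Real.sqrt (1 + ‖v‖ ^ 2)) * angularMomentumSq x v ^ l)) =
      ENNReal.ofReal (Real.sqrt (1 + ‖v‖ ^ 2) * Φ (1 - β * Real.sqrt (1 + ‖v‖ ^ 2))) *
        ENNReal.ofReal (angularMomentumSq x v ^ l) := fun v => by
    rw [← mul_assoc, ENNReal.ofReal_mul (mul_nonneg (Real.sqrt_nonneg _) (h.nonneg _))]
  simp_rw [hsplit]
  rw [ENNReal.ofReal_mul (p := β⁻¹ ^ (2 * l + 4)) (by positivity), hconst,
    lintegral_radial_mul_angularMomentumSq l hψ hx,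
    mul_left_comm (ENNReal.ofReal (β⁻¹ ^ _)) (angularConstant l * _)]
  refine ⟨mul_le_mul_right ?_ _, mul_le_mul_right ?_ _⟩
  · rw [← lintegral_const_mul' _ _ ENNReal.ofReal_ne_top]
    refine setLIntegral_mono' measurableSet_Ioi fun s hs => ?_
    have hs0 : (0 : ℝ) < s := hs
    rw [← ENNReal.ofReal_mul (by positivity), ← ENNReal.ofReal_mul (by positivity),
      ← ENNReal.ofReal_mul (by positivity)]
    exact ENNReal.ofReal_le_ofReal (h.relativistic_integrand_bounds hl hβ hs0).1
  · rw [← mul_assoc, ← lintegral_const_mul' _ _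
      (ENNReal.mul_ne_top ENNReal.ofReal_ne_top ENNReal.ofReal_ne_top)]
    refine setLIntegral_mono' measurableSet_Ioi fun s hs => ?_
    have hs0 : (0 : ℝ) < s := hs
    rw [← ENNReal.ofReal_mul (by positivity), ← ENNReal.ofReal_mul (by positivity),
      ← ENNReal.ofReal_mul (by positivity), ← ENNReal.ofReal_mul (by positivity),
      mul_comm (β⁻¹ ^ _)]
    exact ENNReal.ofReal_le_ofReal (h.relativistic_integrand_bounds hl hβ hs0).2

end RegularProfile

/-! ### Compact support and finite mass from bounds on a ball -/

theorem lintegral_lt_top_of_le_norm_rpow {l R K : ℝ} (hl : -1 / 2 < l)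
    {F : R3 → ENNReal} (hF : ∀ x, x ≠ 0 → ‖x‖ ≤ R → F x ≤ ENNReal.ofReal (K * ‖x‖ ^ (2 * l)))
    (hF0 : ∀ x, x ≠ 0 → R < ‖x‖ → F x = 0) : ∫⁻ x, F x < ⊤ := by
  set g : ℝ → ℝ := (Set.Iic R).indicator fun s => K * s ^ (2 * l) with hg
  have hint : Integrable fun x : R3 => g ‖x‖ := by
    refine (integrable_fun_norm_addHaar volume).2 ?_
    have h1 : IntegrableOn (fun s : ℝ => K * s ^ (2 * l + 2)) (Set.Ioc 0 (max R 0)) := by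
      have := (intervalIntegral.intervalIntegrable_rpow' (by linarith : -1 < 2 * l + 2)
          (a := 0) (b := max R 0)).const_mul K
      rwa [intervalIntegrable_iff_integrableOn_Ioc_of_le (le_max_right _ _)] at this
    have h2 := ((integrable_indicator_iff measurableSet_Ioc).2 h1).integrableOn (s := Set.Ioi 0)
    refine h2.congr_fun (fun s hs => ?_) measurableSet_Ioi
    have hs0 : (0 : ℝ) < s := hs
    by_cases hsR : s ≤ R
    · have hm : s ∈ Set.Ioc 0 (max R 0) := ⟨hs0, le_max_of_le_left hsR⟩
      have hm' : s ∈ Set.Iic R := hsR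
      simp only [hg, Set.indicator_of_mem hm, Set.indicator_of_mem hm', finrank_euclideanSpace,
        Fintype.card_fin, smul_eq_mul, Nat.add_one_sub_one]
      rw [Real.rpow_add hs0, Real.rpow_two]
      ring
    · have hm : s ∉ Set.Ioc 0 (max R 0) := fun h => by
        rcases le_max_iff.1 h.2 with h | h
        · exact hsR h
        · linarith
      have hm' : s ∉ Set.Iic R := hsR
      simp only [hg, Set.indicator_of_notMem hm, Set.indicator_of_notMem hm', smul_zero]
  refine lt_of_le_of_lt ?_ hint.lintegral_lt_top
  refine lintegral_mono_ae ?_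
  filter_upwards [Measure.ae_ne volume (0 : R3)] with x hx
  rcases le_or_gt ‖x‖ R with h | h
  · rw [hg, Set.indicator_of_mem (show ‖x‖ ∈ Set.Iic R from h)]
    exact hF x hx h
  · rw [hF0 x hx h]
    exact zero_le

theorem hasCompactSupport_of_norm_bounds {f : R3 → R3 → ℝ} {R V : ℝ}
    (hx : ∀ x v, R < ‖x‖ → f x v = 0) (hv : ∀ x v, ‖x‖ ≤ R → V < ‖v‖ → f x v = 0) :
    HasCompactSupport fun z : R3 × R3 => f z.1 z.2 := by
  refine HasCompactSupport.intro ((isCompact_closedBall (0 : R3) R).prod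
    (isCompact_closedBall (0 : R3) V)) fun z hz => ?_
  rcases le_or_gt ‖z.1‖ R with h1 | h1
  · refine hv _ _ h1 (lt_of_not_ge fun h2 => hz ?_)
    exact ⟨by simpa using h1, by simpa using h2⟩
  · exact hx _ _ h1

theorem exists_norm_eq_of_pos {r : ℝ} (hr : 0 < r) : ∃ x : R3, x ≠ 0 ∧ ‖x‖ = r := by
  have h : ‖(r • EuclideanSpace.single 0 1 : R3)‖ = r := by
    simp [norm_smul, abs_of_pos hr]
  exact ⟨_, norm_pos_iff.1 (hr.trans_eq h.symm), h⟩

theorem differentiableAt_of_contDiffOn_Ici {g : ℝ → ℝ} (hg : ContDiffOn ℝ 1 g (Set.Ici 0)) {r : ℝ}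
    (hr : 0 < r) : DifferentiableAt ℝ g r :=
  (hg.contDiffAt (Ici_mem_nhds hr)).differentiableAt one_ne_zero

theorem exists_depth_bound {y : ℝ → ℝ} (hy : ContinuousOn y (Set.Ici 0)) (R : ℝ) :
    ∃ M, 0 ≤ M ∧ ∀ r, 0 ≤ r → r ≤ R → y r ≤ M := by
  obtain ⟨M, hM⟩ := (isCompact_Icc.bddAbove_image (hy.mono Set.Icc_subset_Ici_self :
    ContinuousOn y (Set.Icc 0 R)))
  exact ⟨max M 0, le_max_right _ _, fun r h0 h1 =>
    le_max_of_le_left (hM (Set.mem_image_of_mem y ⟨h0, h1⟩))⟩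

/-- A nonincreasing well depth remains nonpositive once it has become so. -/
theorem depth_nonpos_of_le {y y' : ℝ → ℝ} (hy : ∀ r, 0 < r → HasDerivAt y (y' r) r)
    (hy' : ∀ r, 0 < r → y' r ≤ 0) {R r : ℝ} (hR : 0 < R) (hyR : y R ≤ 0) (hRr : R ≤ r) :
    y r ≤ 0 := by
  have h := monotoneOn_Ioi_of_hasDerivAt_nonneg (b := 0) (f := fun r => -y r)
    (fun r hr => (hy r hr).neg) (fun r hr => by linarith [hy' r hr]) hR (hR.trans_le hRr) hRr
  simp only at h
  linarith

/-! ### The Vlasov-Poisson system -/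

/-- The depth of the well is `y = E0 - U`, and the Poisson equation is `-y' = m / r²`. -/
theorem newtonian_finite_extent {k l E0 c δ : ℝ} {φ : ℝ → ℝ} {f : R3 → R3 → ℝ} {U ρ : ℝ → ℝ}
    (hk : -1 < k) (hl : -1 / 2 < l) (hkl : 0 < k + l + 1 / 2) (hkl' : k < l + 3 / 2)
    (hc : 0 < c) (hδ : 0 < δ) (hφ : AdmissibleProfile Set.univ k E0 c δ φ)
    (hs : IsVlasovPoissonSteadyState φ l f U ρ) :
    HasCompactSupport (fun z : R3 × R3 => f z.1 z.2) ∧ newtonianMass f < ⊤ := by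
  have hq : 0 < l + 1 / 2 := by linarith
  have hΦ := hφ.regularProfile isOpen_univ isUpperSet_univ hk hδ one_pos
  set Φ : ℝ → ℝ := fun τ => Set.univ.indicator φ (E0 - 1 * τ) with hΦ_def
  set J : ℝ → ℝ := depthIntegral Φ (l + 1 / 2) with hJ_def
  set A := densityConstant l with hA_def
  have hA : 0 < A := densityConstant_pos hl
  set y : ℝ → ℝ := fun r => E0 - U r with hy_def
  have hf : ∀ x v, f x v = Φ (y ‖x‖ - ‖v‖ ^ 2 / 2) * angularMomentumSq x v ^ l := by
    intro x v
    rw [hs.ansatz, hΦ_def, newtonianEnergy, hy_def]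
    simp only [Set.indicator_univ]
    congr 2
    ring
  have f_nonneg : ∀ x v, 0 ≤ f x v := fun x v => by
    rw [hf]
    exact mul_nonneg (hΦ.nonneg _) (Real.rpow_nonneg (angularMomentumSq_nonneg _ _) _)
  have hJ0 : ∀ z, 0 ≤ J z := hΦ.depthIntegral_nonneg _
  have hlint : ∀ x : R3, x ≠ 0 → ∫⁻ v, ENNReal.ofReal (f x v) =
      ENNReal.ofReal (A * ‖x‖ ^ (2 * l) * J (y ‖x‖)) := fun x hx => by
    simp_rw [hf]
    exact hΦ.lintegral_newtonian_density hl (Set.mem_univ _) hx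
  have hρ : ∀ r, 0 < r → ρ r = A * r ^ (2 * l) * J (y r) := by
    intro r hr
    obtain ⟨x, hx, rfl⟩ := exists_norm_eq_of_pos hr
    rw [hs.density, integral_eq_lintegral_of_nonneg_ae (Eventually.of_forall (f_nonneg x)),
      hlint x hx, ENNReal.toReal_ofReal (by have := hJ0 (y ‖x‖); positivity)]
    rw [funext (hf x)]
    exact ((hΦ.measurable.comp (by fun_prop)).mul
      (measurable_angularMomentumSq_rpow x l)).aestronglyMeasurable
  have y_cont : ContinuousOn y (Set.Ici 0) := continuousOn_const.sub hs.potential_C1.continuousOn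
  have J_cont : Continuous J := continuous_iff_continuousAt.2 fun z =>
    hΦ.continuousAt_depthIntegral hq (Set.mem_univ _) (lt_add_one z)
  set g : ℝ → ℝ := fun s => A * s ^ (2 * l + 2) * J (y s) with hg_def
  have g_cont : ContinuousOn g (Set.Ici 0) :=
    (continuousOn_const.mul (continuousOn_id.rpow_const fun _ _ => Or.inr (by linarith))).mul
      (J_cont.comp_continuousOn y_cont)
  have g_nonneg : ∀ s, 0 ≤ s → 0 ≤ g s := fun s hs => by
    have := hJ0 (y s)
    positivity
  have hρg : ∀ s, 0 < s → s ^ 2 * ρ s = g s := fun s hs => by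
    rw [hρ s hs, hg_def]
    simp only
    rw [Real.rpow_add hs, Real.rpow_two]
    ring
  -- The mass inside radius `r`.
  set m : ℝ → ℝ := fun r => 4 * Real.pi * ∫ s in (0 : ℝ)..r, g s with hm_def
  have hm : ∀ r, 0 < r → HasDerivAt m (4 * Real.pi * g r) r := by
    intro r hr
    refine HasDerivAt.const_mul _ (intervalIntegral.integral_hasDerivAt_right ?_ ?_ ?_)
    · refine ContinuousOn.intervalIntegrable (g_cont.mono ?_)
      rw [Set.uIcc_of_le hr.le]
      exact Set.Icc_subset_Ici_self
    · exact (g_cont.mono Set.Ioi_subset_Ici_self).stronglyMeasurableAtFilter isOpen_Ioi r hr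
    · exact g_cont.continuousAt (Ici_mem_nhds hr)
  have m_nonneg : ∀ r, 0 < r → 0 ≤ m r := fun r hr =>
    mul_nonneg (by positivity) (intervalIntegral.integral_nonneg hr.le fun s hs => g_nonneg s hs.1)
  have hy : ∀ r, 0 < r → HasDerivAt y (-(m r / r ^ 2)) r := by
    intro r hr
    have h1 := ((differentiableAt_of_contDiffOn_Ici hs.potential_C1 hr).hasDerivAt).const_sub E0
    refine h1.congr_deriv ?_
    rw [hs.poisson r hr, hm_def]
    have : ∫ s in (0 : ℝ)..r, s ^ 2 * ρ s = ∫ s in (0 : ℝ)..r, g s := by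
      refine intervalIntegral.integral_congr_ae (Eventually.of_forall fun s hs => ?_)
      rw [Set.uIoc_of_le hr.le] at hs
      exact hρg s hs.1
    rw [this]
    ring
  obtain ⟨R, hR, hyR⟩ : ∃ R, 0 < R ∧ y R ≤ 0 := by
    by_contra! hpos
    set B := ∫ σ in (0 : ℝ)..1, σ ^ k * (1 - σ) ^ (l + 1 / 2) with hB
    have hBpos : 0 < B := integral_rpow_mul_one_sub_rpow_pos hk hq
    refine no_global_positive_depth (a := 2 * l + 3) (n := k + (l + 1 / 2) + 1)
      (C := 4 * Real.pi * A * (c * 1 ^ k * B)) (by linarith) (by linarith) (by linarith)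
      (by rw [Real.one_rpow]; positivity)
      (e₁ := fun _ => 1) (e₂ := fun _ => 0) hy hm hpos m_nonneg
      (fun r hr => mul_nonneg (by positivity) (g_nonneg r hr.le)) (fun r hr => le_rfl) ?_ ?_
      (fun _ => tendsto_const_nhds) (fun _ => tendsto_const_nhds)
      (fun _ => Eventually.of_forall fun r => by simp)
    · intro ε hε
      have hJε : 0 < J ε := hΦ.depthIntegral_pos (by rw [Real.one_rpow]; positivity) hk hq hε
        (Set.mem_univ _)
      refine ⟨4 * Real.pi * A * J ε, by positivity, fun r hr hεr => ?_⟩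
      have h1 : J ε ≤ J (y r) := hΦ.depthIntegral_mono hq (Set.mem_univ _) hεr
      have h2 : (2 * l + 3 - 1) = 2 * l + 2 := by ring
      rw [h2]
      calc 4 * Real.pi * A * J ε * r ^ (2 * l + 2)
          ≤ 4 * Real.pi * A * J (y r) * r ^ (2 * l + 2) := by gcongr
        _ = 4 * Real.pi * g r := by rw [hg_def]; ring
    · intro hlim
      have hlim' : Tendsto y atTop (𝓝[>] 0) := tendsto_nhdsWithin_iff.2 ⟨hlim, by
        filter_upwards [eventually_gt_atTop 0] with r hr
        exact hpos r hr⟩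
      refine (((hΦ.tendsto_depthIntegral hk hq).comp hlim').const_mul
        (4 * Real.pi * A)).congr' ?_
      filter_upwards [eventually_gt_atTop 0] with r hr
      have h1 := Real.rpow_pos_of_pos hr (2 * l + 2)
      have h2 := Real.rpow_pos_of_pos (hpos r hr) (k + (l + 1 / 2) + 1)
      have h3 : (2 * l + 3 - 1) = 2 * l + 2 := by ring
      simp only [Function.comp, hg_def, hJ_def, h3]
      field_simp
  have hout : ∀ r, R ≤ r → y r ≤ 0 := fun r hr =>
    depth_nonpos_of_le hy (fun s hs => by
      have := m_nonneg s hs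
      have : 0 ≤ m s / s ^ 2 := by positivity
      linarith) hR hyR hr
  obtain ⟨M, hM0, hM⟩ := exists_depth_bound y_cont R
  have hzero : ∀ x v, y ‖x‖ - ‖v‖ ^ 2 / 2 ≤ 0 → f x v = 0 := fun x v h => by
    rw [hf, hΦ.eq_zero _ h, zero_mul]
  have hfx : ∀ x v, R < ‖x‖ → f x v = 0 := fun x v hx => hzero x v (by
    have := hout _ hx.le
    have := sq_nonneg ‖v‖
    linarith)
  refine ⟨hasCompactSupport_of_norm_bounds hfx (V := M + 1) fun x v hx hv => hzero x v ?_, ?_⟩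
  · have := hM _ (norm_nonneg x) hx
    nlinarith
  · refine lintegral_lt_top_of_le_norm_rpow hl (R := R) (K := A * J M) (fun x hx hxR => ?_)
      fun x hx hxR => by simp [hfx x _ hxR]
    rw [hlint x hx]
    refine ENNReal.ofReal_le_ofReal ?_
    have h1 : J (y ‖x‖) ≤ J M := hΦ.depthIntegral_mono hq (Set.mem_univ _)
      (hM _ (norm_nonneg x) hxR)
    calc A * ‖x‖ ^ (2 * l) * J (y ‖x‖) ≤ A * ‖x‖ ^ (2 * l) * J M := by gcongr
      _ = _ := by ring

/-! ### The Vlasov-Einstein system -/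

theorem tendsto_one_sub_exp_neg_div : Tendsto (fun y : ℝ => (1 - Real.exp (-y)) / y) (𝓝[>] 0)
    (𝓝 1) := by
  have h : HasDerivAt (fun y : ℝ => 1 - Real.exp (-y)) 1 0 := by
    have := ((hasDerivAt_neg (0 : ℝ)).exp).const_sub 1
    simpa using this
  have h2 := (hasDerivAt_iff_tendsto_slope.1 h).mono_left
    (nhdsWithin_mono (0 : ℝ) (fun y (hy : 0 < y) => hy.ne'))
  refine h2.congr fun y => ?_
  simp [slope_def_field]

theorem RegularProfile.tendsto_depthIntegral_one_sub_exp {S : Set ℝ} {k C q : ℝ} {Φ : ℝ → ℝ}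
    (h : RegularProfile S k C Φ) (hk : -1 < k) (hq : 0 < q) :
    Tendsto (fun y => depthIntegral Φ q (1 - Real.exp (-y)) / y ^ (k + q + 1)) (𝓝[>] 0)
      (𝓝 (C * ∫ σ in (0 : ℝ)..1, σ ^ k * (1 - σ) ^ q)) := by
  have hη : Tendsto (fun y : ℝ => 1 - Real.exp (-y)) (𝓝[>] 0) (𝓝[>] 0) := by
    refine tendsto_nhdsWithin_iff.2 ⟨?_, ?_⟩
    · have : Continuous fun y : ℝ => 1 - Real.exp (-y) := by fun_prop
      simpa using (this.tendsto 0).mono_left nhdsWithin_le_nhds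
    · filter_upwards [self_mem_nhdsWithin] with y hy
      have : Real.exp (-y) < 1 := Real.exp_lt_one_iff.2 (neg_lt_zero.2 hy)
      simp only [Set.mem_Ioi]
      linarith
  have h1 := ((h.tendsto_depthIntegral hk hq).comp hη).mul
    (tendsto_one_sub_exp_neg_div.rpow_const (p := k + q + 1) (Or.inl one_ne_zero))
  rw [Real.one_rpow, mul_one] at h1
  refine h1.congr' ?_
  filter_upwards [self_mem_nhdsWithin] with y hy
  have hy0 : (0 : ℝ) < y := hy
  have hη0 : 0 < 1 - Real.exp (-y) := sub_pos.2 (Real.exp_lt_one_iff.2 (neg_lt_zero.2 hy))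
  have h2 := Real.rpow_pos_of_pos hη0 (k + q + 1)
  have h3 := Real.rpow_pos_of_pos hy0 (k + q + 1)
  simp only [Function.comp]
  rw [Real.div_rpow hη0.le hy0.le]
  field_simp

/-- The depth of the well is `y = log E0 - μ`, and `m = r (1 - exp (-2 λ)) / 2`. The first field
equation becomes `m' = 4 π r² ρ`, the second one `-y' = exp (2 λ) (m / r² + 4 π r p)`. As `y → 0`,
`exp (2 λ) → 1` since `m / r ≤ y`, and the pressure is negligible against the density since only
velocities with `|v|² < exp (2 y) - 1` occur. -/
theorem relativistic_finite_extent {k l E0 c δ : ℝ} {φ : ℝ → ℝ} {f : R3 → R3 → ℝ}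
    {lam mu ρ p : ℝ → ℝ}
    (hk : -1 < k) (hl : -1 / 2 < l) (hkl : 0 < k + l + 1 / 2) (hkl' : k < l + 3 / 2)
    (hc : 0 < c) (hδ : 0 < δ) (hφ : AdmissibleProfile (Set.Ioi 0) k E0 c δ φ)
    (hs : IsVlasovEinsteinSteadyState φ l f lam mu ρ p) :
    HasCompactSupport (fun z : R3 × R3 => f z.1 z.2) ∧ admMass f < ⊤ := by
  have hq : 0 < l + 1 / 2 := by linarith
  have hE0 : 0 < E0 := hφ.cutoff_mem
  have hΦ := hφ.regularProfile isOpen_Ioi (isUpperSet_Ioi 0) hk hδ hE0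
  set Φ : ℝ → ℝ := fun τ => (Set.Ioi 0).indicator φ (E0 - E0 * τ) with hΦ_def
  set C := c * E0 ^ k with hC_def
  have hC : 0 < C := mul_pos hc (Real.rpow_pos_of_pos hE0 _)
  set J : ℝ → ℝ := depthIntegral Φ (l + 1 / 2) with hJ_def
  set A := densityConstant l with hA_def
  have hA : 0 < A := densityConstant_pos hl
  set y : ℝ → ℝ := fun r => Real.log E0 - mu r with hy_def
  have hexp : ∀ r, Real.exp (mu r) = E0 * Real.exp (-y r) := fun r => by
    rw [hy_def]
    simp only [neg_sub]
    rw [Real.exp_sub, Real.exp_log hE0]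
    field_simp
  have hmem : ∀ z : ℝ, 1 - Real.exp (-z) ∈ {Y | E0 - E0 * Y ∈ Set.Ioi 0} := fun z => by
    have := mul_pos hE0 (Real.exp_pos (-z))
    simp only [Set.mem_ofPred_eq, Set.mem_Ioi]
    linarith
  have hf : ∀ x v, f x v = Φ (1 - Real.exp (-y ‖x‖) * Real.sqrt (1 + ‖v‖ ^ 2)) *
      angularMomentumSq x v ^ l := by
    intro x v
    have h1 : E0 - E0 * (1 - Real.exp (-y ‖x‖) * Real.sqrt (1 + ‖v‖ ^ 2)) =
        relativisticEnergy mu x v := by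
      rw [relativisticEnergy, hexp]
      ring
    have h2 : relativisticEnergy mu x v ∈ Set.Ioi (0 : ℝ) :=
      mul_pos (Real.exp_pos _) (Real.sqrt_pos.2 (by positivity))
    rw [hs.ansatz, hΦ_def]
    simp only [h1]
    rw [Set.indicator_of_mem h2]
  have f_nonneg : ∀ x v, 0 ≤ f x v := fun x v => by
    rw [hf]
    exact mul_nonneg (hΦ.nonneg _) (Real.rpow_nonneg (angularMomentumSq_nonneg _ _) _)
  have f_meas : ∀ x, Measurable (f x) := fun x => by
    rw [funext (hf x)]
    exact (hΦ.measurable.comp (by fun_prop)).mul (measurable_angularMomentumSq_rpow x l)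
  have ρ_int_nonneg : ∀ x v, 0 ≤ Real.sqrt (1 + ‖v‖ ^ 2) * f x v := fun x v =>
    mul_nonneg (Real.sqrt_nonneg _) (f_nonneg x v)
  have ρ_int_meas : ∀ x, Measurable fun v : R3 => Real.sqrt (1 + ‖v‖ ^ 2) * f x v := fun x =>
    Measurable.mul (by fun_prop) (f_meas x)
  have hJ0 : ∀ z, 0 ≤ J z := hΦ.depthIntegral_nonneg _
  have hbounds : ∀ x : R3, x ≠ 0 →
      ENNReal.ofReal (A * ‖x‖ ^ (2 * l) * J (1 - Real.exp (-y ‖x‖))) ≤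
        ∫⁻ v, ENNReal.ofReal (Real.sqrt (1 + ‖v‖ ^ 2) * f x v) ∧
      ∫⁻ v, ENNReal.ofReal (Real.sqrt (1 + ‖v‖ ^ 2) * f x v) ≤
        ENNReal.ofReal (Real.exp (y ‖x‖) ^ (2 * l + 4) *
          (A * ‖x‖ ^ (2 * l) * J (1 - Real.exp (-y ‖x‖)))) := fun x hx => by
    have := hΦ.lintegral_relativistic_density_bounds hl (Real.exp_pos (-y ‖x‖)) (hmem _) hx
    rw [← Real.exp_neg, neg_neg] at this
    simp_rw [hf]
    exact this
  have ρ_integrable : ∀ x : R3, x ≠ 0 → Integrable fun v => Real.sqrt (1 + ‖v‖ ^ 2) * f x v :=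
    fun x hx => by
      refine (lintegral_ofReal_ne_top_iff_integrable (ρ_int_meas x).aestronglyMeasurable
        (Eventually.of_forall (ρ_int_nonneg x))).1 ?_
      exact ((hbounds x hx).2.trans_lt ENNReal.ofReal_lt_top).ne
  have hρ : ∀ r, 0 < r → A * r ^ (2 * l) * J (1 - Real.exp (-y r)) ≤ ρ r ∧
      ρ r ≤ Real.exp (y r) ^ (2 * l + 4) * (A * r ^ (2 * l) * J (1 - Real.exp (-y r))) := by
    intro r hr
    obtain ⟨x, hx, rfl⟩ := exists_norm_eq_of_pos hr
    have h := hbounds x hx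
    have hJx := hJ0 (1 - Real.exp (-y ‖x‖))
    rw [← ofReal_integral_eq_lintegral_ofReal (ρ_integrable x hx)
      (Eventually.of_forall (ρ_int_nonneg x)), ← hs.density] at h
    have hρ0 : 0 ≤ ρ ‖x‖ := by
      rw [hs.density]
      exact integral_nonneg (ρ_int_nonneg x)
    exact ⟨(ENNReal.ofReal_le_ofReal_iff hρ0).1 h.1,
      (ENNReal.ofReal_le_ofReal_iff (by positivity)).1 h.2⟩
  have hρ0 : ∀ r, 0 < r → 0 ≤ ρ r := fun r hr => by
    have := hJ0 (1 - Real.exp (-y r))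
    exact le_trans (by positivity) (hρ r hr).1
  have hp0 : ∀ r, 0 < r → 0 ≤ p r := fun r hr => by
    obtain ⟨x, hx, rfl⟩ := exists_norm_eq_of_pos hr
    rw [hs.pressure]
    exact integral_nonneg fun v =>
      div_nonneg (mul_nonneg (sq_nonneg _) (f_nonneg x v)) (Real.sqrt_nonneg _)
  -- Only velocities with `1 + |v|² < exp (2 y)` occur.
  have hzero : ∀ x v, Real.exp (y ‖x‖) ≤ Real.sqrt (1 + ‖v‖ ^ 2) → f x v = 0 := fun x v h => by
    rw [hf, hΦ.eq_zero, zero_mul]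
    have h1 : Real.exp (-y ‖x‖) * Real.exp (y ‖x‖) = 1 := by rw [← Real.exp_add]; simp
    have h2 := mul_le_mul_of_nonneg_left h (Real.exp_pos (-y ‖x‖)).le
    linarith
  have hpρ : ∀ r, 0 < r → 0 < y r → p r ≤ (Real.exp (y r) ^ 2 - 1) * ρ r := by
    intro r hr h0
    obtain ⟨x, hx, rfl⟩ := exists_norm_eq_of_pos hr
    rw [hs.pressure, hs.density, ← integral_const_mul]
    refine integral_mono_of_nonneg (Eventually.of_forall fun v =>
      div_nonneg (mul_nonneg (sq_nonneg _) (f_nonneg x v)) (Real.sqrt_nonneg _))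
      ((ρ_integrable x hx).const_mul _) (Eventually.of_forall fun v => ?_)
    simp only
    rcases le_or_gt (Real.exp (y ‖x‖)) (Real.sqrt (1 + ‖v‖ ^ 2)) with h1 | h1
    · simp [hzero x v h1]
    · have hsq : Real.sqrt (1 + ‖v‖ ^ 2) ^ 2 = 1 + ‖v‖ ^ 2 := Real.sq_sqrt (by positivity)
      have hone : 1 ≤ Real.sqrt (1 + ‖v‖ ^ 2) := Real.one_le_sqrt.2 (by nlinarith [sq_nonneg ‖v‖])
      have hfv := f_nonneg x v
      have hx0 : 0 < ‖x‖ := hr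
      have hinner : (inner ℝ x v / ‖x‖) ^ 2 ≤ ‖v‖ ^ 2 := by
        rw [div_pow, div_le_iff₀ (by positivity)]
        have := abs_real_inner_le_norm x v
        calc (inner ℝ x v) ^ 2 = |inner ℝ x v| ^ 2 := (sq_abs _).symm
          _ ≤ (‖x‖ * ‖v‖) ^ 2 := by gcongr
          _ = ‖v‖ ^ 2 * ‖x‖ ^ 2 := by ring
      have hv2 : ‖v‖ ^ 2 ≤ Real.exp (y ‖x‖) ^ 2 - 1 := by nlinarith
      calc (inner ℝ x v / ‖x‖) ^ 2 * f x v / Real.sqrt (1 + ‖v‖ ^ 2)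
          ≤ (inner ℝ x v / ‖x‖) ^ 2 * f x v := div_le_self (by positivity) hone
        _ ≤ (Real.exp (y ‖x‖) ^ 2 - 1) * f x v := by gcongr; exact hinner.trans hv2
        _ ≤ (Real.exp (y ‖x‖) ^ 2 - 1) * (Real.sqrt (1 + ‖v‖ ^ 2) * f x v) := by
            refine mul_le_mul_of_nonneg_left ?_ ((sq_nonneg ‖v‖).trans hv2)
            exact le_mul_of_one_le_left hfv hone
  -- The mass inside radius `r`, read off from the metric.
  set m : ℝ → ℝ := fun r => r * (1 - Real.exp (-2 * lam r)) / 2 with hm_def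
  have hm : ∀ r, 0 < r → HasDerivAt m (4 * Real.pi * r ^ 2 * ρ r) r := by
    intro r hr
    have h1 := (differentiableAt_of_contDiffOn_Ici hs.lam_C1 hr).hasDerivAt
    have h2 := ((hasDerivAt_id r).mul (((h1.const_mul (-2)).exp).const_sub 1)).div_const 2
    refine h2.congr_deriv ?_
    have h3 := hs.field1 r hr
    simp only [id]
    linear_combination h3 / 2
  have m'_nonneg : ∀ r, 0 < r → 0 ≤ 4 * Real.pi * r ^ 2 * ρ r := fun r hr => by
    have := hρ0 r hr
    positivity
  have m_nonneg : ∀ r, 0 < r → 0 ≤ m r := by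
    intro r hr
    have hcont : ContinuousOn m (Set.Ici 0) :=
      (continuousOn_id.mul (continuousOn_const.sub
        (Real.continuous_exp.comp_continuousOn (continuousOn_const.mul
          hs.lam_C1.continuousOn)))).div_const 2
    have hlim : Tendsto m (𝓝[>] 0) (𝓝 0) := by
      have h := (hcont 0 Set.self_mem_Ici).tendsto.mono_left
        (nhdsWithin_mono 0 Set.Ioi_subset_Ici_self)
      simpa [hm_def] using h
    refine le_of_tendsto hlim ?_
    filter_upwards [Ioc_mem_nhdsGT hr] with s hs
    exact monotoneOn_Ioi_of_hasDerivAt_nonneg hm m'_nonneg hs.1 hr hs.2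
  have hlam : ∀ r, 0 < r → Real.exp (-2 * lam r) = 1 - 2 * m r / r := fun r hr => by
    rw [hm_def]
    field_simp
    ring
  have hmu : ∀ r, 0 < r → Real.exp (-2 * lam r) * deriv mu r =
      m r / r ^ 2 + 4 * Real.pi * r * p r := by
    intro r hr
    have h1 := hs.field2 r hr
    have h2 := hlam r hr
    have h3 : Real.exp (-2 * lam r) * (2 * r * deriv mu r) =
        2 * m r / r + 8 * Real.pi * r ^ 2 * p r := by
      linear_combination h1 - h2
    have h4 : Real.exp (-2 * lam r) * deriv mu r =
        (2 * m r / r + 8 * Real.pi * r ^ 2 * p r) / (2 * r) := by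
      rw [← h3]
      field_simp
    rw [h4]
    field_simp
    ring
  have hy : ∀ r, 0 < r → HasDerivAt y (-deriv mu r) r := fun r hr =>
    ((differentiableAt_of_contDiffOn_Ici hs.mu_C1 hr).hasDerivAt).const_sub _
  have y_cont : ContinuousOn y (Set.Ici 0) := continuousOn_const.sub hs.mu_C1.continuousOn
  have hmu_lower : ∀ r, 0 < r → m r / r ^ 2 ≤ deriv mu r := by
    intro r hr
    have h1 := hmu r hr
    have h2 := m_nonneg r hr
    have h3 := hp0 r hr
    have h4 : 0 ≤ m r / r ^ 2 := by positivity
    have h5 : 0 ≤ 4 * Real.pi * r * p r := by positivity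
    have h6 : Real.exp (-2 * lam r) ≤ 1 := by
      rw [hlam r hr]
      have : 0 ≤ 2 * m r / r := by positivity
      linarith
    have h7 : 0 ≤ deriv mu r := by
      refine nonneg_of_mul_nonneg_right (a := Real.exp (-2 * lam r)) ?_ (Real.exp_pos _)
      linarith
    nlinarith
  obtain ⟨R, hR, hyR⟩ : ∃ R, 0 < R ∧ y R ≤ 0 := by
    by_contra! hpos
    set B := ∫ σ in (0 : ℝ)..1, σ ^ k * (1 - σ) ^ (l + 1 / 2) with hB
    have hBpos : 0 < B := integral_rpow_mul_one_sub_rpow_pos hk hq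
    have hy'_le : ∀ r, 0 < r → -deriv mu r ≤ -(m r / r ^ 2) := fun r hr =>
      neg_le_neg (hmu_lower r hr)
    have a_eq : 2 * l + 3 - 1 = 2 + 2 * l := by ring
    refine no_global_positive_depth (a := 2 * l + 3) (n := k + (l + 1 / 2) + 1)
      (C := 4 * Real.pi * A * (C * B)) (by linarith) (by linarith) (by linarith) (by positivity)
      (e₁ := fun r => (1 - 2 * y r)⁻¹) (e₂ := fun r => Real.exp (y r) ^ 2 - 1) hy hm hpos m_nonneg
      m'_nonneg hy'_le ?_ ?_ ?_ ?_ ?_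
    · intro ε hε
      have hη : 0 < 1 - Real.exp (-ε) := sub_pos.2 (Real.exp_lt_one_iff.2 (neg_lt_zero.2 hε))
      have hJε : 0 < J (1 - Real.exp (-ε)) := hΦ.depthIntegral_pos hC hk hq hη (hmem ε)
      refine ⟨4 * Real.pi * A * J (1 - Real.exp (-ε)), by positivity, fun r hr hεr => ?_⟩
      have h1 : J (1 - Real.exp (-ε)) ≤ J (1 - Real.exp (-y r)) :=
        hΦ.depthIntegral_mono hq (hmem _) (by gcongr)
      rw [a_eq, Real.rpow_add hr, Real.rpow_two]
      have h2 := (hρ r hr).1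
      calc 4 * Real.pi * A * J (1 - Real.exp (-ε)) * (r ^ 2 * r ^ (2 * l))
          ≤ 4 * Real.pi * A * J (1 - Real.exp (-y r)) * (r ^ 2 * r ^ (2 * l)) := by gcongr
        _ = 4 * Real.pi * r ^ 2 * (A * r ^ (2 * l) * J (1 - Real.exp (-y r))) := by ring
        _ ≤ 4 * Real.pi * r ^ 2 * ρ r := by gcongr
    · intro hlim
      have hlim' : Tendsto y atTop (𝓝[>] 0) := tendsto_nhdsWithin_iff.2 ⟨hlim, by
        filter_upwards [eventually_gt_atTop 0] with r hr
        exact hpos r hr⟩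
      have h1 := ((hΦ.tendsto_depthIntegral_one_sub_exp hk hq).comp hlim').const_mul
        (4 * Real.pi * A)
      have hexp1 : Tendsto (fun r => Real.exp (y r) ^ (2 * l + 4)) atTop (𝓝 1) := by
        have := ((Real.continuous_exp.tendsto 0).comp hlim).rpow_const (p := 2 * l + 4)
          (Or.inl (Real.exp_pos 0).ne')
        simpa using this
      have h2 := hexp1.mul h1
      rw [one_mul] at h2
      refine tendsto_of_tendsto_of_tendsto_of_le_of_le' h1 h2 ?_ ?_
      all_goals
        filter_upwards [eventually_gt_atTop 0] with r hr
        have hr2 := Real.rpow_pos_of_pos hr (2 * l)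
        have hyn := Real.rpow_pos_of_pos (hpos r hr) (k + (l + 1 / 2) + 1)
        have hden : 0 < r ^ (2 * l + 3 - 1) * y r ^ (k + (l + 1 / 2) + 1) :=
          mul_pos (Real.rpow_pos_of_pos hr _) hyn
        simp only [Function.comp]
      · rw [le_div_iff₀ hden, a_eq, Real.rpow_add hr, Real.rpow_two]
        have h3 := mul_le_mul_of_nonneg_left (hρ r hr).1
          (by positivity : 0 ≤ 4 * Real.pi * r ^ 2)
        refine le_of_eq_of_le ?_ h3
        rw [hJ_def]
        generalize y r ^ (k + (l + 1 / 2) + 1) = N at hyn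
        field_simp
      · rw [div_le_iff₀ hden, a_eq, Real.rpow_add hr, Real.rpow_two]
        have h3 := mul_le_mul_of_nonneg_left (hρ r hr).2
          (by positivity : 0 ≤ 4 * Real.pi * r ^ 2)
        refine le_of_le_of_eq h3 ?_
        rw [hJ_def]
        generalize y r ^ (k + (l + 1 / 2) + 1) = N at hyn
        field_simp
    · intro hlim
      have : Tendsto (fun r => (1 - 2 * y r)⁻¹) atTop (𝓝 (1 - 2 * 0)⁻¹) :=
        ((hlim.const_mul 2).const_sub 1).inv₀ (by norm_num)
      simpa using this
    · intro hlim
      have := (((Real.continuous_exp.tendsto 0).comp hlim).pow 2).sub_const 1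
      simpa using this
    · intro hlim
      filter_upwards [hlim.eventually (gt_mem_nhds (by norm_num : (0 : ℝ) < 1 / 4)),
        eventually_gt_atTop 0] with r hr4 hr
      have h1 := hmu r hr
      have h2 := mass_le_radius_mul_depth hy hm hpos m'_nonneg hy'_le r hr
      have h3 : 1 - 2 * y r ≤ Real.exp (-2 * lam r) := by
        rw [hlam r hr]
        have : 2 * m r / r ≤ 2 * y r := by
          rw [div_le_iff₀ hr]
          linarith
        linarith
      have h4 : p r ≤ (Real.exp (y r) ^ 2 - 1) * ρ r :=
        hpρ r hr (hpos r hr)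
      have h5 : 0 < 1 - 2 * y r := by linarith
      have h6 : 0 ≤ deriv mu r := le_trans
        (div_nonneg (m_nonneg r hr) (by positivity)) (hmu_lower r hr)
      rw [neg_neg, inv_mul_eq_div, le_div_iff₀ h5]
      calc deriv mu r * (1 - 2 * y r) ≤ deriv mu r * Real.exp (-2 * lam r) := by gcongr
        _ = m r / r ^ 2 + 4 * Real.pi * r * p r := by rw [mul_comm, h1]
        _ ≤ m r / r ^ 2 + 4 * Real.pi * r * ((Real.exp (y r) ^ 2 - 1) * ρ r) := by gcongr
        _ = _ := by field_simp
  have hout : ∀ r, R ≤ r → y r ≤ 0 := fun r hr =>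
    depth_nonpos_of_le hy (fun s hs => by
      have := m_nonneg s hs
      have : 0 ≤ m s / s ^ 2 := by positivity
      linarith [hmu_lower s hs]) hR hyR hr
  obtain ⟨M, hM0, hM⟩ := exists_depth_bound y_cont R
  have hone : ∀ v : R3, 1 ≤ Real.sqrt (1 + ‖v‖ ^ 2) := fun v =>
    Real.one_le_sqrt.2 (by nlinarith [sq_nonneg ‖v‖])
  have hfx : ∀ x v, R < ‖x‖ → f x v = 0 := fun x v hx =>
    hzero x v ((Real.exp_le_one_iff.2 (hout _ hx.le)).trans (hone v))
  refine ⟨hasCompactSupport_of_norm_bounds hfx (V := Real.exp M) fun x v hx hv =>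
    hzero x v ?_, ?_⟩
  · have h1 : Real.exp (y ‖x‖) ≤ Real.exp M := Real.exp_le_exp.2 (hM _ (norm_nonneg x) hx)
    refine (h1.trans hv.le).trans (Real.le_sqrt_of_sq_le ?_)
    linarith
  · refine lintegral_lt_top_of_le_norm_rpow hl (R := R)
      (K := Real.exp M ^ (2 * l + 4) * A * J (1 - Real.exp (-M))) (fun x hx hxR => ?_)
      fun x hx hxR => by simp [hfx x _ hxR]
    refine (hbounds x hx).2.trans (ENNReal.ofReal_le_ofReal ?_)
    have hyM := hM _ (norm_nonneg x) hxR
    have h1 : J (1 - Real.exp (-y ‖x‖)) ≤ J (1 - Real.exp (-M)) :=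
      hΦ.depthIntegral_mono hq (hmem _) (by gcongr)
    have h2 : Real.exp (y ‖x‖) ^ (2 * l + 4) ≤ Real.exp M ^ (2 * l + 4) :=
      Real.rpow_le_rpow (Real.exp_pos _).le (Real.exp_le_exp.2 hyM) (by linarith)
    have h3 := hJ0 (1 - Real.exp (-y ‖x‖))
    calc Real.exp (y ‖x‖) ^ (2 * l + 4) * (A * ‖x‖ ^ (2 * l) * J (1 - Real.exp (-y ‖x‖)))
        ≤ Real.exp M ^ (2 * l + 4) * (A * ‖x‖ ^ (2 * l) * J (1 - Real.exp (-M))) := by gcongr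
      _ = _ := by ring

theorem theorem3p1 (k l : ℝ) (hk : -1 < k) (hl : -1 / 2 < l) (hkl : 0 < k + l + 1 / 2)
    (hkl' : k < l + 3 / 2) :
    (∀ (φ : ℝ → ℝ) (E0 c δ : ℝ), 0 < c → 0 < δ → AdmissibleProfile Set.univ k E0 c δ φ →
      ∀ (f : R3 → R3 → ℝ) (U ρ : ℝ → ℝ), IsVlasovPoissonSteadyState φ l f U ρ →
        HasCompactSupport (fun z : R3 × R3 => f z.1 z.2) ∧ newtonianMass f < ⊤) ∧
    (∀ (φ : ℝ → ℝ) (E0 c δ : ℝ), 0 < c → 0 < δ → AdmissibleProfile (Set.Ioi 0) k E0 c δ φ →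
      ∀ (f : R3 → R3 → ℝ) (lam mu ρ p : ℝ → ℝ), IsVlasovEinsteinSteadyState φ l f lam mu ρ p →
        HasCompactSupport (fun z : R3 × R3 => f z.1 z.2) ∧ admMass f < ⊤) := by
  refine ⟨fun φ E0 c δ hc hδ hφ f U ρ hs => ?_, fun φ E0 c δ hc hδ hφ f lam mu ρ p hs => ?_⟩
  · exact newtonian_finite_extent hk hl hkl hkl' hc hδ hφ hs
  · exact relativistic_finite_extent hk hl hkl hkl' hc hδ hφ hs
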